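/- Let $\mu=\mu_0\delta_0+\mu_1\delta_1$ be a probability distribution on $\{0,1\}$ and let $(p_{ij})_{i,j\in\{0,1\}}$ be a stochastic matrix with $p_{ij}<1$ for all $i,j$. For $n\ge 1$ let $n$ independent infinite binary strings be given, each of them a homogeneous Markov chain on $\{0,1\}$ with initial distribution $\mu$ and transition matrix $(p_{ij})$, and let a rank be given that is uniformly distributed on $\{1,\dots,n\}$ and independent of the strings. Radix Selection with two buckets finds the string of this rank (in lexicographic order) as follows: while the current bucket (at first all $n$ strings) contains at least two strings, all its strings are distributed into two buckets according to their next digit, and the algorithm proceeds with the one that contains the sought string. Each assignment of a string to a bucket is one bucket operation. Let $W_n$ be the total number of bucket operations. Then $W_n$ is almost surely finite with finite mean, and, as $n\to\infty$, $$\mathbb{E}[W_n]=\kappa_\mu n+o(n),\qquad \kappa_\mu:=\mu_0^2\kappa_0+(1-\mu_0)^2\kappa_1+1>0,$$ where $$\kappa_0=\frac{1+p_{01}^2-p_{11}^2}{2(p_{00}+p_{11})(1+p_{00}p_{11})-2(p_{00}+p_{11})^2}>0,\qquad \kappa_1=\frac{1+p_{10}^2-p_{00}^2}{2(p_{00}+p_{11})(1+p_{00}p_{11})-2(p_{00}+p_{11})^2}>0.$$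 Moreover, there is exactly one pair of probability laws on $\mathbb{R}$ of integrable random variables $Z^0,Z^1$ that solves the system $$Z^i\stackrel{d}{=}B_{p_{i0}}\,p_{i0}Z^0+(1-B_{p_{i0}})(1-p_{i0})Z^1+1,\qquad i=0,1,$$ where, for each $i$, the variables $B_{p_{i0}},Z^0,Z^1$ on the right-hand side are independent and $B_q$ denotes a Bernoulli variable with success probability $q$; and $\mathbb{E}[Z^i]=\kappa_i$ for $i=0,1$. With these laws, as $n\to\infty$, $$\frac{W_n}{n}\stackrel{d}{\longrightarrow}Z_\mu\stackrel{d}{=}B_{\mu_0}\,\mu_0Z^0+(1-B_{\mu_0})(1-\mu_0)Z^1+1,$$ where $B_{\mu_0},Z^0,Z^1$ are independent, and the convergence holds with all moments: for every $k\in\mathbb{N}$ the $k$-th moments of $W_n/n$ and of $Z_\mu$ are finite and $\mathbb{E}[(W_n/n)^k]\to\mathbb{E}[Z_\mu^k]$. -/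

import Mathlib

open MeasureTheory ProbabilityTheory Filter Topology
open scoped ENNReal

noncomputable section

namespace RadixSelection

/-- One partitioning stage on binary strings `x 0, …, x (n-1)`. The state is the set of indices of
the data in the current bucket together with the rank of the sought datum inside this bucket.
Stage `k` reads digit number `k` (digits are numbered from `0`) of each datum of the bucket and
passes to the sub-bucket that contains the sought rank. -/
def step {n : ℕ} (x : Fin n → ℕ → Fin 2) (k : ℕ) (s : Finset (Fin n) × ℕ) :
    Finset (Fin n) × ℕ :=
  if s.2 ≤ (s.1.filter fun i => x i k = 0).card then
    (s.1.filter fun i => x i k = 0, s.2)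
  else
    (s.1.filter fun i => x i k = 1, s.2 - (s.1.filter fun i => x i k = 0).card)

/-- The bucket and the rank inside it before stage `k`, when rank `ℓ` is to be selected. -/
def state {n : ℕ} (x : Fin n → ℕ → Fin 2) (ℓ : ℕ) : ℕ → Finset (Fin n) × ℕ
  | 0 => (Finset.univ, ℓ)
  | k + 1 => step x k (state x ℓ k)

/-- The number of bucket operations of Radix Selection with two buckets selecting rank `ℓ`
(`1 ≤ ℓ ≤ n`): a stage that starts with a bucket of `m ≥ 2` data costs `m` operations, and the
algorithm stops as soon as the current bucket contains no further datum. The value is `∞` if the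
algorithm does not stop. -/
def bucketOps {n : ℕ} (x : Fin n → ℕ → Fin 2) (ℓ : ℕ) : ℝ≥0∞ :=
  ∑' k : ℕ, if 2 ≤ (state x ℓ k).1.card then ((state x ℓ k).1.card : ℝ≥0∞) else 0

/-- The random string `X` is a homogeneous Markov chain on `{0, 1}` with initial distribution `μ`
and transition matrix `p`. -/
def IsMarkovChain {Ω : Type*} [MeasurableSpace Ω] (P : Measure Ω) (μ : Fin 2 → ℝ)
    (p : Matrix (Fin 2) (Fin 2) ℝ) (X : Ω → ℕ → Fin 2) : Prop :=
  ∀ (k : ℕ) (s : ℕ → Fin 2),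
    P {ω | ∀ j ≤ k, X ω j = s j} =
      ENNReal.ofReal (μ (s 0) * ∏ j ∈ Finset.range k, p (s j) (s (j + 1)))

/-- The data `X` are `n` independent strings, each generated by the Markov source `(μ, p)`, and
the rank `R` is uniformly distributed on `{1, …, n}` and independent of the data. -/
structure IsUniformRankModel {Ω : Type*} [MeasurableSpace Ω] (P : Measure Ω) (μ : Fin 2 → ℝ)
    (p : Matrix (Fin 2) (Fin 2) ℝ) (n : ℕ) (X : Fin n → Ω → ℕ → Fin 2) (R : Ω → ℕ) : Prop where
  measurable_data : ∀ i, Measurable (X i)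
  markov_data : ∀ i, IsMarkovChain P μ p (X i)
  indep_data : iIndepFun X P
  measurable_rank : Measurable R
  uniform_rank : ∀ ℓ ∈ Finset.Icc 1 n, P {ω | R ω = ℓ} = (n : ℝ≥0∞)⁻¹
  indep_rank : IndepFun (fun ω i => X i ω) R P

/-- The Bernoulli distribution with success probability `q`, as a law on `ℝ`. -/
def bernoulliLaw (q : ℝ) : Measure ℝ :=
  ENNReal.ofReal q • Measure.dirac 1 + ENNReal.ofReal (1 - q) • Measure.dirac 0

/-- The law of `B q Z⁰ + (1 - B) (1 - q) Z¹ + 1`, where `B, Z⁰, Z¹` are independent, `B` is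
Bernoulli with success probability `q`, and `Z⁰, Z¹` have laws `ν₀, ν₁`. -/
def mixLaw (q : ℝ) (ν₀ ν₁ : Measure ℝ) : Measure ℝ :=
  ((bernoulliLaw q).prod (ν₀.prod ν₁)).map
    fun t => t.1 * q * t.2.1 + (1 - t.1) * (1 - q) * t.2.2 + 1

/-- The laws `ν 0, ν 1` of `Z⁰, Z¹` are integrable and solve
`Zⁱ =ᵈ B_{p i 0} p_{i0} Z⁰ + (1 - B_{p i 0}) (1 - p_{i0}) Z¹ + 1` for `i = 0, 1`. -/
def IsIntegrableSolution (p : Matrix (Fin 2) (Fin 2) ℝ) (ν : Fin 2 → ProbabilityMeasure ℝ) :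
    Prop :=
  ∀ i, Integrable (fun x : ℝ => x) (ν i : Measure ℝ) ∧
    (ν i : Measure ℝ) = mixLaw (p i 0) (ν 0 : Measure ℝ) (ν 1 : Measure ℝ)

/-- The common denominator of the constants `κ₀, κ₁`. -/
def kappaDenom (p : Matrix (Fin 2) (Fin 2) ℝ) : ℝ :=
  2 * (p 0 0 + p 1 1) * (1 + p 0 0 * p 1 1) - 2 * (p 0 0 + p 1 1) ^ 2

/-- The constant `κ₀`. -/
def kappa0 (p : Matrix (Fin 2) (Fin 2) ℝ) : ℝ :=
  (1 + p 0 1 ^ 2 - p 1 1 ^ 2) / kappaDenom p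

/-- The constant `κ₁`. -/
def kappa1 (p : Matrix (Fin 2) (Fin 2) ℝ) : ℝ :=
  (1 + p 1 0 ^ 2 - p 0 0 ^ 2) / kappaDenom p

/-- The constant `κ_μ`. -/
def kappa (μ : Fin 2 → ℝ) (p : Matrix (Fin 2) (Fin 2) ℝ) : ℝ :=
  μ 0 ^ 2 * kappa0 p + (1 - μ 0) ^ 2 * kappa1 p + 1

end RadixSelection

end

noncomputable section

namespace RadixSelection

/-! For pairwise distinct strings, the search for a rank follows one string, and different ranks
follow different strings (`exists_followed`). The strings are almost surely distinct and
exchangeable, so a uniform rank costs, in law, as much as following one fixed string `j`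
(`IsUniformRankModel.map_bucketOps`). That cost is explicit: every other string is paid for in each
stage that it shares with `j`, and `j` itself in each stage in which it has company. This is the sum
of the numbers of shared stages plus their maximum (`followCost`).

Given that string `j` equals `y`, these numbers are independent and identically distributed. They
exceed `k` with the probability that the source produces the first `k` digits of `y`, so they have
geometric tails and mean `pathCost p μ y`, the sum of these probabilities. The conditional variance
of the sum is `O(n)` and the maximum is negligible. Hence cost over `n` differs from `pathCost` of
string `j` by `O(1/n)` in mean square (`integral_error_le`), with moments bounded uniformly in `n`
(`integral_followCost_pow_le`). Testing against bounded Lipschitz functions and powers then gives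
errors `O(1/√n)`, hence convergence in law and of all moments.

The limit is the law of `pathCost` under the source. Splitting off the first digit (`pathCost_eq`)
turns this series into the distributional equations (`map_pathCost`). They have one solution because
the equations for characteristic functions contract the argument by `ρ < 1` (`solution_unique`); the
means solve a linear two by two system (`means_eq_kappa`). -/

/-- Binary strings. -/
abbrev Str := ℕ → Fin 2

/-! ### The cost of following a fixed string -/

/-- The number of stages in which two distinct strings share a bucket. -/
def sharedStages (x y : Str) : ℕ := PiNat.firstDiff x y + 1

lemma mem_cylinder_iff_lt_sharedStages {x y : Str} (h : x ≠ y) (k : ℕ) :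
    x ∈ PiNat.cylinder y k ↔ k < sharedStages x y := by
  rw [PiNat.mem_cylinder_iff_le_firstDiff h, sharedStages, Nat.lt_succ_iff]

/-- The number of bucket operations when the search follows the string number `j`. -/
def followCost {n : ℕ} (x : Fin n → Str) (j : Fin n) : ℕ :=
  ∑ i ∈ Finset.univ.erase j, sharedStages (x i) (x j) +
    (Finset.univ.erase j).sup fun i => sharedStages (x i) (x j)

lemma tsum_ite_lt (a : ℕ) : ∑' k : ℕ, (if k < a then (1 : ℝ≥0∞) else 0) = a := by
  rw [tsum_eq_sum (s := Finset.range a) (fun k hk => by simpa using hk)]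
  rw [Finset.sum_congr rfl (g := fun _ => 1) (fun k hk => by simpa using hk)]
  simp

/-- The set of strings that agree with string number `j` in the first `k` digits. -/
def prefixClass {n : ℕ} (x : Fin n → Str) (j : Fin n) (k : ℕ) : Finset (Fin n) :=
  Finset.univ.filter fun i => ∀ m < k, x i m = x j m

lemma card_prefixClass {n : ℕ} {x : Fin n → Str} (hx : Function.Injective x) (j : Fin n)
    (k : ℕ) : (prefixClass x j k).card =
      ((Finset.univ.erase j).filter fun i => k < sharedStages (x i) (x j)).card + 1 := by
  have : prefixClass x j k =
      insert j ((Finset.univ.erase j).filter fun i => k < sharedStages (x i) (x j)) := by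
    ext i
    simp only [prefixClass, Finset.mem_filter, Finset.mem_univ, true_and, Finset.mem_insert,
      Finset.mem_erase, and_true]
    by_cases h : i = j
    · simp [h]
    · rw [← mem_cylinder_iff_lt_sharedStages (hx.ne h)]
      simp [h, PiNat.mem_cylinder_iff]
  rw [this, Finset.card_insert_of_notMem (by simp)]

/-- A stage with `m ≥ 2` strings costs `m - 1` for the companions of `j` and `1` for `j`. Summed
over the stages, the companions give the sum in `followCost`. String `j` pays while at least one
companion is left, which lasts as long as the maximum. -/
lemma tsum_card_prefixClass {n : ℕ} {x : Fin n → Str} (hx : Function.Injective x) (j : Fin n) :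
    ∑' k : ℕ, (if 2 ≤ (prefixClass x j k).card then ((prefixClass x j k).card : ℝ≥0∞) else 0) =
      followCost x j := by
  have key : ∀ k : ℕ,
      (if 2 ≤ (prefixClass x j k).card then ((prefixClass x j k).card : ℝ≥0∞) else 0) =
      ∑ i ∈ Finset.univ.erase j, (if k < sharedStages (x i) (x j) then (1 : ℝ≥0∞) else 0) +
      (if k < (Finset.univ.erase j).sup (fun i => sharedStages (x i) (x j))
        then (1 : ℝ≥0∞) else 0) := by
    intro k
    rw [card_prefixClass hx]
    set s := (Finset.univ.erase j).filter fun i => k < sharedStages (x i) (x j) with hs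
    have h1 : ∑ i ∈ Finset.univ.erase j,
        (if k < sharedStages (x i) (x j) then (1 : ℝ≥0∞) else 0) = s.card := by
      rw [Finset.sum_ite]; simp [hs]
    have h2 : k < (Finset.univ.erase j).sup (fun i => sharedStages (x i) (x j)) ↔
        2 ≤ s.card + 1 := by
      rw [Finset.lt_sup_iff]
      have : 2 ≤ s.card + 1 ↔ 0 < s.card := by omega
      rw [this, Finset.card_pos, hs, Finset.filter_nonempty_iff]
    rw [h1, if_congr h2 rfl rfl]
    split_ifs with h
    · push_cast; rfl
    · have : s.card = 0 := by omega
      simp [this]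
  simp_rw [key]
  rw [ENNReal.tsum_add, tsum_ite_lt, Summable.tsum_finsetSum (fun _ _ => ENNReal.summable)]
  simp_rw [tsum_ite_lt]
  simp [followCost]

/-! ### The correspondence between ranks and followed strings -/

lemma state_succ {n : ℕ} (x : Fin n → Str) (ℓ k : ℕ) :
    state x ℓ (k + 1) = step x k (state x ℓ k) := rfl

lemma card_filter_digit {n : ℕ} (x : Fin n → Str) (k : ℕ) (C : Finset (Fin n)) :
    (C.filter fun i => x i k = 0).card + (C.filter fun i => x i k = 1).card = C.card := by
  rw [← Finset.card_filter_add_card_filter_not (s := C) (fun i => x i k = 0)]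
  congr 2
  ext i
  simp only [Finset.mem_filter]
  have : ∀ a : Fin 2, a = 1 ↔ ¬ a = 0 := by decide
  rw [this]

lemma step_fst_subset {n : ℕ} (x : Fin n → Str) (k : ℕ) (s : Finset (Fin n) × ℕ) :
    (step x k s).1 ⊆ s.1 := by
  unfold step
  split_ifs <;> exact Finset.filter_subset _ _

lemma state_rank_bounds {n : ℕ} (x : Fin n → Str) {ℓ : ℕ} (hℓ : ℓ ∈ Finset.Icc 1 n) (k : ℕ) :
    1 ≤ (state x ℓ k).2 ∧ (state x ℓ k).2 ≤ (state x ℓ k).1.card := by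
  induction k with
  | zero => simpa [state] using hℓ
  | succ k ih =>
    rw [state_succ, step]
    have := card_filter_digit x k (state x ℓ k).1
    split_ifs with h
    · exact ⟨ih.1, h⟩
    · dsimp only
      omega

/-- Any member determines its bucket: each stage keeps exactly the strings with one common digit. -/
lemma state_fst_eq_prefixClass {n : ℕ} (x : Fin n → Str) (ℓ k : ℕ) {j : Fin n}
    (hj : j ∈ (state x ℓ k).1) : (state x ℓ k).1 = prefixClass x j k := by
  induction k with
  | zero => simp [state, prefixClass]
  | succ k ih =>
    have hj' : j ∈ (state x ℓ k).1 := step_fst_subset x k _ hj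
    have hC := ih hj'
    have key : ∀ a : Fin 2, x j k = a →
        ((state x ℓ k).1.filter fun i => x i k = a) = prefixClass x j (k + 1) := by
      intro a ha
      rw [hC]
      ext i
      simp only [prefixClass, Finset.mem_filter, Finset.mem_univ, true_and]
      rw [Nat.forall_lt_succ_right, ha]
    rw [state_succ, step] at hj ⊢
    split_ifs at hj ⊢ with h
    · exact key 0 (Finset.mem_filter.mp hj).2
    · exact key 1 (Finset.mem_filter.mp hj).2

/-- A stage can be undone. The new bucket is nonempty, and any of its members reveals both the old
bucket and the digit chosen; the digit tells whether a count was subtracted from the rank. -/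
lemma state_injOn {n : ℕ} (x : Fin n → Str) (k : ℕ) :
    Set.InjOn (fun ℓ => state x ℓ k) (Finset.Icc 1 n : Finset ℕ) := by
  induction k with
  | zero => intro a _ b _ h; simpa [state] using h
  | succ k ih =>
    intro a ha b hb h
    have ha' := state_rank_bounds x ha
    have hb' := state_rank_bounds x hb
    have hne : (state x a (k + 1)).1.Nonempty := by
      rw [← Finset.card_pos]; have := ha' (k + 1); omega
    obtain ⟨j, hj⟩ := hne
    have hjb : j ∈ (state x b (k + 1)).1 := by
      have h' : state x a (k + 1) = state x b (k + 1) := h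
      rwa [← h']
    have hC : (state x a k).1 = (state x b k).1 := by
      rw [state_fst_eq_prefixClass x a k (step_fst_subset x k _ hj),
        state_fst_eq_prefixClass x b k (step_fst_subset x k _ hjb)]
    apply ih ha hb
    refine Prod.ext hC ?_
    simp only [state_succ, step] at h hj hjb
    rw [← hC] at h hjb
    split_ifs at h hj hjb with h1 h2 h2
    · exact (Prod.ext_iff.mp h).2
    · have e1 := (Finset.mem_filter.mp hj).2
      have e2 := (Finset.mem_filter.mp hjb).2
      rw [e1] at e2; exact absurd e2 (by decide)
    · have e1 := (Finset.mem_filter.mp hj).2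
      have e2 := (Finset.mem_filter.mp hjb).2
      rw [e1] at e2; exact absurd e2 (by decide)
    · have := (Prod.ext_iff.mp h).2
      dsimp only at this ⊢
      omega

lemma state_fst_antitone {n : ℕ} (x : Fin n → Str) (ℓ : ℕ) :
    Antitone fun k => (state x ℓ k).1 :=
  antitone_nat_of_succ_le fun k => step_fst_subset x k _

/-- For pairwise distinct strings, selecting rank `ℓ` follows one string through all stages, and
every string is followed for exactly one rank. -/
lemma exists_followed {n : ℕ} {x : Fin n → Str} (hx : Function.Injective x) :
    ∃ σ : ℕ → Fin n → Prop, (∀ ℓ ∈ Finset.Icc 1 n, ∃ j, σ ℓ j) ∧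
      (∀ ℓ ∈ Finset.Icc 1 n, ∀ ℓ' ∈ Finset.Icc 1 n, ∀ j, σ ℓ j → σ ℓ' j → ℓ = ℓ') ∧
      ∀ ℓ j, σ ℓ j → bucketOps x ℓ = followCost x j := by
  -- From stage `K` on all strings are separated, so every bucket is a singleton.
  obtain ⟨K, hK⟩ : ∃ K, ∀ i j, i ≠ j → sharedStages (x i) (x j) ≤ K := by
    refine ⟨(Finset.univ : Finset (Fin n × Fin n)).sup
      fun q => sharedStages (x q.1) (x q.2), fun i j _ => ?_⟩
    exact Finset.le_sup (f := fun q : Fin n × Fin n => sharedStages (x q.1) (x q.2))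
      (Finset.mem_univ (i, j))
  have hsing : ∀ j, prefixClass x j K = {j} := by
    intro j
    ext i
    simp only [prefixClass, Finset.mem_filter, Finset.mem_univ, true_and, Finset.mem_singleton]
    refine ⟨fun h => ?_, fun h => by simp [h]⟩
    by_contra hij
    have h1 : x i ∈ PiNat.cylinder (x j) K := h
    rw [mem_cylinder_iff_lt_sharedStages (hx.ne hij)] at h1
    exact absurd h1 (not_lt.mpr (hK i j hij))
  refine ⟨fun ℓ j => ∀ k, j ∈ (state x ℓ k).1, ?_, ?_, ?_⟩
  · intro ℓ hℓ
    have hne : ∀ k, (state x ℓ k).1.Nonempty := fun k => by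
      rw [← Finset.card_pos]; have := state_rank_bounds x hℓ k; omega
    obtain ⟨j, hj⟩ := hne K
    refine ⟨j, fun k => ?_⟩
    rcases le_total k K with h | h
    · exact state_fst_antitone x ℓ h hj
    · obtain ⟨i, hi⟩ := hne k
      have : i ∈ (state x ℓ K).1 := state_fst_antitone x ℓ h hi
      rw [state_fst_eq_prefixClass x ℓ K hj, hsing, Finset.mem_singleton] at this
      rwa [← this]
  · intro ℓ hℓ ℓ' hℓ' j h h'
    -- At stage `K` both searches are in the bucket `{j}`, where the rank can only be `1`; equal
    -- states come from equal ranks.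
    apply state_injOn x K hℓ hℓ'
    have e := state_fst_eq_prefixClass x ℓ K (h K)
    have e' := state_fst_eq_prefixClass x ℓ' K (h' K)
    have b := state_rank_bounds x hℓ K
    have b' := state_rank_bounds x hℓ' K
    rw [hsing] at e e'
    rw [e] at b
    rw [e'] at b'
    simp only [Finset.card_singleton] at b b'
    refine Prod.ext (e.trans e'.symm) ?_
    dsimp only
    omega
  · intro ℓ j h
    rw [← tsum_card_prefixClass hx, bucketOps]
    refine tsum_congr fun k => ?_
    rw [state_fst_eq_prefixClass x ℓ k (h k)]

/-- An injection of `n` ranks into `n` strings is a bijection. The general `F` is what allows laws,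
not only means, to be compared. -/
lemma sum_bucketOps {n : ℕ} {x : Fin n → Str} (hx : Function.Injective x) (F : ℝ≥0∞ → ℝ≥0∞) :
    ∑ ℓ ∈ Finset.Icc 1 n, F (bucketOps x ℓ) = ∑ j, F (followCost x j) := by
  obtain ⟨σ, h1, h2, h3⟩ := exists_followed hx
  rcases n.eq_zero_or_pos with rfl | hn
  · simp
  have : Nonempty (Fin n) := ⟨⟨0, hn⟩⟩
  choose! f hf using h1
  have hinj : Set.InjOn f (Finset.Icc 1 n : Finset ℕ) := fun a ha b hb h =>
    h2 a ha b hb _ (hf a ha) (h ▸ hf b hb)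
  have himg : (Finset.Icc 1 n).image f = Finset.univ := by
    rw [← Finset.card_eq_iff_eq_univ, Finset.card_image_of_injOn hinj]
    simp
  rw [← himg, Finset.sum_image hinj]
  exact Finset.sum_congr rfl fun ℓ hℓ => by rw [h3 ℓ _ (hf ℓ hℓ)]

/-! ### Prefix probabilities and the limit functional -/

/-- The string without its first digit. -/
def shiftStr (y : Str) : Str := fun m => y (m + 1)

/-- The string `y` with the digit `a` put in front. -/
def consStr (a : Fin 2) (y : Str) : Str
  | 0 => a
  | m + 1 => y m

@[simp] lemma consStr_zero (a : Fin 2) (y : Str) : consStr a y 0 = a := rfl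

@[simp] lemma shiftStr_consStr (a : Fin 2) (y : Str) : shiftStr (consStr a y) = y := rfl

lemma measurable_shiftStr : Measurable shiftStr :=
  measurable_pi_iff.mpr fun m => measurable_pi_apply (m + 1)

lemma measurable_consStr (a : Fin 2) : Measurable (consStr a) :=
  measurable_pi_iff.mpr fun m => by
    cases m with
    | zero => exact measurable_const
    | succ m => exact measurable_pi_apply m

lemma mem_cylinder_succ {x y : Str} {k : ℕ} :
    x ∈ PiNat.cylinder y (k + 1) ↔ x 0 = y 0 ∧ shiftStr x ∈ PiNat.cylinder (shiftStr y) k := by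
  rw [PiNat.mem_cylinder_iff, PiNat.mem_cylinder_iff, Nat.forall_lt_succ_left]
  rfl

lemma measurableSet_cylinder (y : Str) (k : ℕ) : MeasurableSet (PiNat.cylinder y k) :=
  (PiNat.isOpen_cylinder _ y k).measurableSet

/-- The probability that a Markov source produces the first `k` digits of `y`. -/
def prefixProb (p : Matrix (Fin 2) (Fin 2) ℝ) : (Fin 2 → ℝ) → Str → ℕ → ℝ
  | _, _, 0 => 1
  | μ, y, k + 1 => μ (y 0) * prefixProb p (p (y 0)) (shiftStr y) k

variable {p : Matrix (Fin 2) (Fin 2) ℝ} {μ : Fin 2 → ℝ} {ρ : ℝ}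

@[simp] lemma prefixProb_zero (y : Str) : prefixProb p μ y 0 = 1 := rfl

lemma prefixProb_succ (y : Str) (k : ℕ) :
    prefixProb p μ y (k + 1) = μ (y 0) * prefixProb p (p (y 0)) (shiftStr y) k := rfl

lemma prefixProb_succ_eq_prod (y : Str) (k : ℕ) :
    prefixProb p μ y (k + 1) = μ (y 0) * ∏ j ∈ Finset.range k, p (y j) (y (j + 1)) := by
  induction k generalizing μ y with
  | zero => rfl
  | succ k ih =>
    rw [prefixProb_succ, ih, Finset.prod_range_succ', mul_comm (∏ _ ∈ _, _)]
    rfl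

lemma prefixProb_nonneg (hμ : ∀ i, 0 ≤ μ i) (hp : ∀ i j, 0 ≤ p i j) (y : Str) (k : ℕ) :
    0 ≤ prefixProb p μ y k := by
  induction k generalizing μ y with
  | zero => exact zero_le_one
  | succ k ih => exact mul_nonneg (hμ _) (ih (hp _) _)

lemma prefixProb_row_le (hp : ∀ i j, 0 ≤ p i j) (hρ : ∀ i j, p i j ≤ ρ) (i : Fin 2) (y : Str)
    (k : ℕ) : prefixProb p (p i) y k ≤ ρ ^ k := by
  induction k generalizing i y with
  | zero => simp
  | succ k ih =>
    rw [prefixProb_succ, pow_succ']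
    exact mul_le_mul (hρ _ _) (ih _ _) (prefixProb_nonneg (hp _) hp _ _)
      ((hp i 0).trans (hρ i 0))

/-- One power of `ρ` is lost compared with a row start, since `μ` may be concentrated on one digit.
-/
lemma prefixProb_succ_le (hμ1 : ∀ i, μ i ≤ 1) (hp : ∀ i j, 0 ≤ p i j)
    (hρ : ∀ i j, p i j ≤ ρ) (y : Str) (k : ℕ) : prefixProb p μ y (k + 1) ≤ ρ ^ k := by
  rw [prefixProb_succ]
  calc _ ≤ 1 * ρ ^ k := mul_le_mul (hμ1 _) (prefixProb_row_le hp hρ _ _ _)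
        (prefixProb_nonneg (hp _) hp _ _) zero_le_one
    _ = _ := one_mul _

lemma summable_prefixProb (hμ : ∀ i, 0 ≤ μ i) (hμ1 : ∀ i, μ i ≤ 1) (hp : ∀ i j, 0 ≤ p i j)
    (hρ : ∀ i j, p i j ≤ ρ) (hρ1 : ρ < 1) (y : Str) : Summable (prefixProb p μ y) := by
  rw [← summable_nat_add_iff 1]
  exact Summable.of_nonneg_of_le (fun k => prefixProb_nonneg hμ hp _ _)
    (fun k => prefixProb_succ_le hμ1 hp hρ y k)
    (summable_geometric_of_lt_one ((hp 0 0).trans (hρ 0 0)) hρ1)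

/-- The limit of the normalized cost of following a string `y` from the source `(μ, p)`. -/
def pathCost (p : Matrix (Fin 2) (Fin 2) ℝ) (μ : Fin 2 → ℝ) (y : Str) : ℝ :=
  ∑' k, prefixProb p μ y k

lemma pathCost_nonneg (hμ : ∀ i, 0 ≤ μ i) (hp : ∀ i j, 0 ≤ p i j) (y : Str) :
    0 ≤ pathCost p μ y := tsum_nonneg fun _ => prefixProb_nonneg hμ hp _ _

lemma pathCost_le (hμ : ∀ i, 0 ≤ μ i) (hμ1 : ∀ i, μ i ≤ 1) (hp : ∀ i j, 0 ≤ p i j)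
    (hρ : ∀ i j, p i j ≤ ρ) (hρ1 : ρ < 1) (y : Str) : pathCost p μ y ≤ 1 + (1 - ρ)⁻¹ := by
  have hρ0 : 0 ≤ ρ := (hp 0 0).trans (hρ 0 0)
  have hs := summable_prefixProb hμ hμ1 hp hρ hρ1 y
  rw [pathCost, hs.tsum_eq_zero_add, prefixProb_zero, ← tsum_geometric_of_lt_one hρ0 hρ1]
  gcongr
  · exact (summable_nat_add_iff 1).mpr hs
  · exact summable_geometric_of_lt_one hρ0 hρ1
  · exact prefixProb_succ_le hμ1 hp hρ y _

lemma pathCost_eq (hμ : ∀ i, 0 ≤ μ i) (hμ1 : ∀ i, μ i ≤ 1) (hp : ∀ i j, 0 ≤ p i j)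
    (hρ : ∀ i j, p i j ≤ ρ) (hρ1 : ρ < 1) (y : Str) :
    pathCost p μ y = μ (y 0) * pathCost p (p (y 0)) (shiftStr y) + 1 := by
  rw [pathCost, (summable_prefixProb hμ hμ1 hp hρ hρ1 y).tsum_eq_zero_add, prefixProb_zero,
    add_comm, pathCost, ← tsum_mul_left]
  rfl

lemma measurable_prefixProb (k : ℕ) : Measurable fun y => prefixProb p μ y k := by
  cases k with
  | zero => exact measurable_const
  | succ k =>
    simp_rw [prefixProb_succ_eq_prod]
    refine Measurable.mul (Measurable.of_discrete.comp (measurable_pi_apply 0)) ?_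
    refine Finset.measurable_fun_prod _ fun j _ => ?_
    have : Measurable fun q : Fin 2 × Fin 2 => p q.1 q.2 := Measurable.of_discrete
    have hy : Measurable fun y : Str => (y j, y (j + 1)) :=
      (measurable_pi_apply j).prodMk (measurable_pi_apply (j + 1))
    exact this.comp hy

lemma measurable_pathCost (hμ : ∀ i, 0 ≤ μ i) (hμ1 : ∀ i, μ i ≤ 1) (hp : ∀ i j, 0 ≤ p i j)
    (hρ : ∀ i j, p i j ≤ ρ) (hρ1 : ρ < 1) : Measurable (pathCost p μ) := by
  refine measurable_of_tendsto_metrizable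
    (f := fun n y => ∑ k ∈ Finset.range n, prefixProb p μ y k)
    (fun n => Finset.measurable_fun_sum _ fun k _ => measurable_prefixProb k) ?_
  rw [tendsto_pi_nhds]
  exact fun y => (summable_prefixProb hμ hμ1 hp hρ hρ1 y).hasSum.tendsto_sum_nat

/-! ### Laws of Markov strings -/

/-- `κ` is the law of a string produced by the Markov source `(μ, p)`. -/
def IsChainLaw (p : Matrix (Fin 2) (Fin 2) ℝ) (μ : Fin 2 → ℝ) (κ : Measure Str) : Prop :=
  ∀ y k, κ (PiNat.cylinder y k) = ENNReal.ofReal (prefixProb p μ y k)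

lemma IsMarkovChain.isChainLaw {Ω : Type*} [MeasurableSpace Ω] {P : Measure Ω}
    [IsProbabilityMeasure P] {X : Ω → Str} (h : IsMarkovChain P μ p X) (hX : Measurable X) :
    IsChainLaw p μ (P.map X) := by
  intro y k
  rw [Measure.map_apply hX (measurableSet_cylinder y k)]
  cases k with
  | zero => simp
  | succ k =>
    rw [prefixProb_succ_eq_prod, ← h k y]
    congr 1
    ext ω
    simp [PiNat.mem_cylinder_iff]

lemma IsChainLaw.isProbabilityMeasure {κ : Measure Str} (h : IsChainLaw p μ κ) :
    IsProbabilityMeasure κ :=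
  ⟨by have := h 0 0; simpa using this⟩

lemma generateFrom_cylinders : (inferInstance : MeasurableSpace Str) =
    MeasurableSpace.generateFrom {s | ∃ (x : Str) (n : ℕ), s = PiNat.cylinder x n} := by
  rw [← (PiNat.isTopologicalBasis_cylinders fun _ => Fin 2).borel_eq_generateFrom]
  exact BorelSpace.measurable_eq

lemma isPiSystem_cylinders :
    IsPiSystem {s : Set Str | ∃ (x : Str) (n : ℕ), s = PiNat.cylinder x n} := by
  have key : ∀ (x y : Str) (m n : ℕ), m ≤ n →
      (PiNat.cylinder x m ∩ PiNat.cylinder y n).Nonempty →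
      PiNat.cylinder x m ∩ PiNat.cylinder y n = PiNat.cylinder y n := by
    intro x y m n hmn ⟨z, hz1, hz2⟩
    rw [Set.inter_eq_right]
    rw [PiNat.mem_cylinder_iff_eq] at hz1 hz2
    rw [← hz1, ← hz2]
    exact PiNat.cylinder_anti z hmn
  rintro _ ⟨x, m, rfl⟩ _ ⟨y, n, rfl⟩ hne
  rcases le_total m n with h | h
  · exact ⟨y, n, key x y m n h hne⟩
  · rw [Set.inter_comm] at hne ⊢
    exact ⟨x, m, key y x n m h hne⟩

lemma IsChainLaw.unique {κ κ' : Measure Str} (h : IsChainLaw p μ κ) (h' : IsChainLaw p μ κ') :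
    κ = κ' := by
  have := h.isProbabilityMeasure
  have := h'.isProbabilityMeasure
  refine ext_of_generate_finite _ generateFrom_cylinders isPiSystem_cylinders ?_ (by simp)
  rintro _ ⟨x, n, rfl⟩
  rw [h, h']

/-- Conditioning a given chain on digit number `1` being `i` and dropping two digits leaves, by the
Markov property, a chain started from row `i`. Digit number `0` would not do, because `μ i` may
vanish. -/
lemma exists_chainLaw_row {κ : Measure Str} (h : IsChainLaw p μ κ) (hμ : ∀ i, 0 ≤ μ i)
    (hp : ∀ i j, 0 ≤ p i j) (i : Fin 2) (hpos : 0 < μ 0 * p 0 i + μ 1 * p 1 i) :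
    ∃ κ' : Measure Str, IsChainLaw p (p i) κ' := by
  refine ⟨(ENNReal.ofReal (μ 0 * p 0 i + μ 1 * p 1 i))⁻¹ •
    (κ.restrict {x | x 1 = i}).map (fun x => shiftStr (shiftStr x)), fun y k => ?_⟩
  have hm : Measurable fun x : Str => shiftStr (shiftStr x) :=
    measurable_shiftStr.comp measurable_shiftStr
  rw [Measure.smul_apply, Measure.map_apply hm (measurableSet_cylinder y k),
    Measure.restrict_apply (hm (measurableSet_cylinder y k))]
  have hset : (fun x => shiftStr (shiftStr x)) ⁻¹' PiNat.cylinder y k ∩ {x : Str | x 1 = i} =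
      PiNat.cylinder (consStr 0 (consStr i y)) (k + 2) ∪
        PiNat.cylinder (consStr 1 (consStr i y)) (k + 2) := by
    ext x
    have hx : x 0 = 0 ∨ x 0 = 1 := by generalize x 0 = a; revert a; decide
    have h1 : shiftStr x 0 = x 1 := rfl
    simp only [Set.mem_inter_iff, Set.mem_preimage, Set.mem_ofPred_eq, Set.mem_union,
      mem_cylinder_succ, consStr_zero, shiftStr_consStr, h1]
    tauto
  have hdisj : Disjoint (PiNat.cylinder (consStr 0 (consStr i y)) (k + 2))
      (PiNat.cylinder (consStr 1 (consStr i y)) (k + 2)) := by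
    rw [Set.disjoint_left]
    intro x h0 h1
    rw [mem_cylinder_succ] at h0 h1
    have := h0.1.symm.trans h1.1
    simp at this
  have h0 := prefixProb_nonneg (hp i) hp y k
  rw [hset, measure_union hdisj (measurableSet_cylinder _ _), h, h, ← ENNReal.ofReal_add
    (prefixProb_nonneg hμ hp _ _) (prefixProb_nonneg hμ hp _ _)]
  simp only [prefixProb_succ, consStr_zero, shiftStr_consStr]
  rw [← mul_assoc, ← mul_assoc, ← add_mul, ENNReal.ofReal_mul hpos.le, smul_eq_mul, ← mul_assoc,
    ENNReal.inv_mul_cancel (by simpa using hpos) ENNReal.ofReal_ne_top, one_mul]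

lemma chainLaw_eq_sum {κ : Measure Str} (h : IsChainLaw p μ κ) (hμ : ∀ i, 0 ≤ μ i)
    (hμs : μ 0 + μ 1 = 1) {κr : Fin 2 → Measure Str} (hr : ∀ i, IsChainLaw p (p i) (κr i)) :
    κ = ENNReal.ofReal (μ 0) • (κr 0).map (consStr 0) +
      ENNReal.ofReal (μ 1) • (κr 1).map (consStr 1) := by
  have := fun i => (hr i).isProbabilityMeasure
  refine h.unique fun y k => ?_
  rw [Measure.add_apply, Measure.smul_apply, Measure.smul_apply,
    Measure.map_apply (measurable_consStr 0) (measurableSet_cylinder y k),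
    Measure.map_apply (measurable_consStr 1) (measurableSet_cylinder y k)]
  cases k with
  | zero => simp [← ENNReal.ofReal_add (hμ 0) (hμ 1), hμs]
  | succ k =>
    have hpre : ∀ a, consStr a ⁻¹' PiNat.cylinder y (k + 1) =
        {x | a = y 0 ∧ x ∈ PiNat.cylinder (shiftStr y) k} := by
      intro a; ext x
      simp only [Set.mem_preimage, mem_cylinder_succ, consStr_zero, shiftStr_consStr,
        Set.mem_ofPred_eq]
    rw [hpre, hpre, prefixProb_succ, ENNReal.ofReal_mul (hμ _)]
    have hy : y 0 = 0 ∨ y 0 = 1 := by generalize y 0 = a; revert a; decide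
    rcases hy with hy | hy <;> simp only [hy, ← hr _ (shiftStr y) k] <;>
      simp [PiNat.cylinder]

/-! ### The distributional equations -/

lemma mixLaw_eq {q : ℝ} (ν₀ ν₁ : Measure ℝ) [IsProbabilityMeasure ν₀] [IsProbabilityMeasure ν₁] :
    mixLaw q ν₀ ν₁ = ENNReal.ofReal q • ν₀.map (fun x => q * x + 1) +
      ENNReal.ofReal (1 - q) • ν₁.map (fun x => (1 - q) * x + 1) := by
  have hm : Measurable fun t : ℝ × ℝ × ℝ =>
      t.1 * q * t.2.1 + (1 - t.1) * (1 - q) * t.2.2 + 1 := by fun_prop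
  rw [mixLaw, bernoulliLaw, Measure.add_prod, Measure.prod_smul_left, Measure.prod_smul_left,
    Measure.dirac_prod, Measure.dirac_prod, Measure.map_add _ _ hm, Measure.map_smul,
    Measure.map_smul, Measure.map_map hm (by fun_prop), Measure.map_map hm (by fun_prop)]
  congr 2
  · have : ν₀ = (ν₀.prod ν₁).map Prod.fst := by simp [Measure.map_fst_prod]
    conv_rhs => rw [this]
    rw [Measure.map_map (by fun_prop) (by fun_prop)]
    congr 1
    ext t
    simp
  · have : ν₁ = (ν₀.prod ν₁).map Prod.snd := by simp [Measure.map_snd_prod]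
    conv_rhs => rw [this]
    rw [Measure.map_map (by fun_prop) (by fun_prop)]
    congr 1
    ext t
    simp

/-- The first digit plays the role of the Bernoulli variable; given that it is `i`, the rest of the
string is a chain started from row `i`, and `pathCost_eq` supplies the affine map. -/
lemma map_pathCost {κ : Measure Str} (h : IsChainLaw p μ κ) (hμ : ∀ i, 0 ≤ μ i)
    (hμs : μ 0 + μ 1 = 1) (hp : ∀ i j, 0 ≤ p i j) (hρ : ∀ i j, p i j ≤ ρ) (hρ1 : ρ < 1)
    {κr : Fin 2 → Measure Str} (hr : ∀ i, IsChainLaw p (p i) (κr i)) :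
    κ.map (pathCost p μ) =
      mixLaw (μ 0) ((κr 0).map (pathCost p (p 0))) ((κr 1).map (pathCost p (p 1))) := by
  have hμ1 : ∀ i, μ i ≤ 1 := by
    rw [Fin.forall_fin_two]; constructor <;> linarith [hμ 0, hμ 1]
  have hmr : ∀ i, Measurable (pathCost p (p i)) := fun i =>
    measurable_pathCost (hp i) (fun j => (hρ i j).trans hρ1.le) hp hρ hρ1
  have hm := measurable_pathCost hμ hμ1 hp hρ hρ1
  have := fun i => (hr i).isProbabilityMeasure
  have := fun i => Measure.isProbabilityMeasure_map (μ := κr i) (hmr i).aemeasurable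
  rw [mixLaw_eq, chainLaw_eq_sum h hμ hμs hr, Measure.map_add _ _ hm, Measure.map_smul,
    Measure.map_smul, Measure.map_map hm (measurable_consStr _),
    Measure.map_map hm (measurable_consStr _), Measure.map_map (by fun_prop) (hmr 0),
    Measure.map_map (by fun_prop) (hmr 1), show 1 - μ 0 = μ 1 by linarith]
  have hc : ∀ i, pathCost p μ ∘ consStr i = (fun x => μ i * x + 1) ∘ pathCost p (p i) := by
    intro i
    ext x
    simp [pathCost_eq hμ hμ1 hp hρ hρ1 (consStr i x)]
  rw [hc, hc]

lemma integral_mixLaw {E : Type*} [NormedAddCommGroup E] [NormedSpace ℝ E] {q : ℝ} (hq : 0 ≤ q)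
    (hq1 : q ≤ 1) {ν₀ ν₁ : Measure ℝ} [IsProbabilityMeasure ν₀] [IsProbabilityMeasure ν₁]
    {f : ℝ → E} (hf : Continuous f)
    (h0 : Integrable (fun x => f (q * x + 1)) ν₀)
    (h1 : Integrable (fun x => f ((1 - q) * x + 1)) ν₁) :
    ∫ x, f x ∂(mixLaw q ν₀ ν₁) =
      q • ∫ x, f (q * x + 1) ∂ν₀ + (1 - q) • ∫ x, f ((1 - q) * x + 1) ∂ν₁ := by
  have hm : ∀ c : ℝ, Measurable fun x : ℝ => c * x + 1 := fun c => by fun_prop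
  have hi : ∀ (c : ℝ) (ν : Measure ℝ), Integrable (fun x => f (c * x + 1)) ν →
      Integrable f (ν.map fun x => c * x + 1) := fun c ν h =>
    (integrable_map_measure hf.aestronglyMeasurable (hm c).aemeasurable).mpr h
  rw [mixLaw_eq, integral_add_measure ((hi _ _ h0).smul_measure ENNReal.ofReal_ne_top)
    ((hi _ _ h1).smul_measure ENNReal.ofReal_ne_top), integral_smul_measure,
    integral_smul_measure, ENNReal.toReal_ofReal hq, ENNReal.toReal_ofReal (by linarith),
    integral_map (hm _).aemeasurable hf.aestronglyMeasurable,
    integral_map (hm _).aemeasurable hf.aestronglyMeasurable]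

/-! ### Uniqueness of the solution -/

lemma charFun_mixLaw {q : ℝ} (hq : 0 ≤ q) (hq1 : q ≤ 1) (ν₀ ν₁ : Measure ℝ)
    [IsProbabilityMeasure ν₀] [IsProbabilityMeasure ν₁] (t : ℝ) :
    charFun (mixLaw q ν₀ ν₁) t = Complex.exp (t * Complex.I) *
      (q * charFun ν₀ (q * t) + (1 - q : ℝ) * charFun ν₁ ((1 - q) * t)) := by
  have hexp : ∀ c x : ℝ, Complex.exp (t * ((c * x + 1 : ℝ) : ℂ) * Complex.I) =
      Complex.exp (t * Complex.I) * Complex.exp ((c * t : ℝ) * x * Complex.I) := by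
    intro c x
    rw [← Complex.exp_add]
    congr 1
    push_cast
    ring
  have hintg : ∀ (c : ℝ) (ν : Measure ℝ) [IsProbabilityMeasure ν],
      Integrable (fun x : ℝ => Complex.exp (t * ((c * x + 1 : ℝ) : ℂ) * Complex.I)) ν := by
    intro c ν _
    refine Integrable.of_bound (C := 1) (by fun_prop) (Eventually.of_forall fun x => ?_)
    rw [← Complex.ofReal_mul, Complex.norm_exp_ofReal_mul_I]
  rw [charFun_apply_real, integral_mixLaw hq hq1 (f := fun x : ℝ => Complex.exp (t * x * Complex.I))
    (by fun_prop) (hintg _ _) (hintg _ _)]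
  simp_rw [hexp, integral_const_mul]
  rw [charFun_apply_real, charFun_apply_real, Complex.real_smul, Complex.real_smul]
  ring

/-- The distance of the characteristic functions at `t` is at most a convex combination of distances
at the points `p i j * t`, which are closer to `0` by the factor `ρ`. Iteration drives the argument
to `0`, where both functions are continuous with value `1`. -/
lemma solution_unique (hp : ∀ i j, 0 ≤ p i j) (hps : ∀ i, p i 0 + p i 1 = 1)
    (hρ : ∀ i j, p i j ≤ ρ) (hρ1 : ρ < 1) {ν ν' : Fin 2 → ProbabilityMeasure ℝ}
    (h : IsIntegrableSolution p ν) (h' : IsIntegrableSolution p ν') : ν' = ν := by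
  have hρ0 : 0 ≤ ρ := (hp 0 0).trans (hρ 0 0)
  set d : Fin 2 → ℝ → ℝ := fun i t =>
    ‖charFun (ν' i : Measure ℝ) t - charFun (ν i : Measure ℝ) t‖ with hd
  have hrec : ∀ i t, d i t ≤ p i 0 * d 0 (p i 0 * t) + p i 1 * d 1 (p i 1 * t) := by
    intro i t
    have h1 : p i 0 ≤ 1 := (hρ i 0).trans hρ1.le
    have e : 1 - p i 0 = p i 1 := by linarith [hps i]
    simp only [hd]
    rw [(h i).2, (h' i).2, charFun_mixLaw (hp i 0) h1, charFun_mixLaw (hp i 0) h1, e, ← mul_sub,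
      norm_mul, Complex.norm_exp_ofReal_mul_I, one_mul, add_sub_add_comm, ← mul_sub, ← mul_sub]
    refine (norm_add_le _ _).trans ?_
    rw [norm_mul, norm_mul, Complex.norm_real, Complex.norm_real, Real.norm_of_nonneg (hp i 0),
      Real.norm_of_nonneg (hp i 1)]
  have hcont : ∀ i, Continuous (d i) := fun i =>
    (continuous_charFun.sub continuous_charFun).norm
  have hzero : ∀ i, d i 0 = 0 := fun i => by simp [hd]
  have hsmall : ∀ ε > 0, ∃ δ > 0, ∀ i, ∀ t, |t| < δ → d i t ≤ ε := by
    intro ε hε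
    have : ∀ i, ∃ δ > 0, ∀ t, |t| < δ → d i t ≤ ε := by
      intro i
      obtain ⟨δ, hδ, H⟩ := Metric.continuous_iff.mp (hcont i) 0 ε hε
      refine ⟨δ, hδ, fun t ht => ?_⟩
      have := H t (by simpa [Real.dist_eq] using ht)
      rw [hzero, Real.dist_eq, sub_zero] at this
      exact (le_abs_self _).trans this.le
    choose δ hδ H using this
    refine ⟨min (δ 0) (δ 1), lt_min (hδ 0) (hδ 1), fun i t ht => H i t (ht.trans_le ?_)⟩
    fin_cases i
    · exact min_le_left _ _
    · exact min_le_right _ _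
  have hiter : ∀ (ε δ : ℝ), (∀ i, ∀ t, |t| < δ → d i t ≤ ε) → ∀ (m : ℕ) (i) (t : ℝ),
      ρ ^ m * |t| < δ → d i t ≤ ε := by
    intro ε δ H m
    induction m with
    | zero => intro i t ht; exact H i t (by simpa using ht)
    | succ m ih =>
      intro i t ht
      have hstep : ∀ j, d j (p i j * t) ≤ ε := fun j => by
        apply ih
        refine lt_of_le_of_lt ?_ ht
        rw [abs_mul, abs_of_nonneg (hp i j), pow_succ, mul_assoc]
        gcongr
        exact hρ i j
      calc d i t ≤ _ := hrec i t
        _ ≤ p i 0 * ε + p i 1 * ε := by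
          gcongr
          · exact hp i 0
          · exact hstep 0
          · exact hp i 1
          · exact hstep 1
        _ = ε := by rw [← add_mul, hps, one_mul]
  have hd0 : ∀ i t, d i t ≤ 0 := by
    intro i t
    refine le_of_forall_pos_le_add fun ε hε => ?_
    obtain ⟨δ, hδ, H⟩ := hsmall ε hε
    have hlim : Tendsto (fun m : ℕ => ρ ^ m * |t|) atTop (𝓝 0) := by
      simpa using (tendsto_pow_atTop_nhds_zero_of_lt_one hρ0 hρ1).mul_const |t|
    obtain ⟨m, hm⟩ := (hlim.eventually (gt_mem_nhds hδ)).exists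
    rw [zero_add]
    exact hiter ε δ H m i t hm
  funext i
  apply ProbabilityMeasure.toMeasure_injective
  refine Measure.ext_of_charFun (funext fun t => ?_)
  have := (hd0 i t).antisymm (norm_nonneg _)
  exact sub_eq_zero.mp (norm_eq_zero.mp this)

/-! ### The means of the solution -/

lemma integral_id_mixLaw {q : ℝ} (hq : 0 ≤ q) (hq1 : q ≤ 1) {ν₀ ν₁ : Measure ℝ}
    [IsProbabilityMeasure ν₀] [IsProbabilityMeasure ν₁] (h0 : Integrable (fun x => x) ν₀)
    (h1 : Integrable (fun x => x) ν₁) :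
    ∫ x, x ∂(mixLaw q ν₀ ν₁) = q ^ 2 * ∫ x, x ∂ν₀ + (1 - q) ^ 2 * ∫ x, x ∂ν₁ + 1 := by
  rw [integral_mixLaw hq hq1 (f := fun x => x) continuous_id
    ((h0.const_mul q).add (integrable_const 1)) ((h1.const_mul (1 - q)).add (integrable_const 1)),
    integral_add (h0.const_mul q) (integrable_const 1),
    integral_add (h1.const_mul (1 - q)) (integrable_const 1), integral_const_mul,
    integral_const_mul]
  simp only [integral_const, probReal_univ, smul_eq_mul, mul_one]
  ring

lemma kappaDenom_pos (hpos : ∀ i j, 0 < p i j) (hlt : ∀ i j, p i j < 1) : 0 < kappaDenom p := by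
  have : kappaDenom p = 2 * (p 0 0 + p 1 1) * ((1 - p 0 0) * (1 - p 1 1)) := by
    rw [kappaDenom]; ring
  rw [this]
  have := hpos 0 0
  have := hpos 1 1
  have := sub_pos.mpr (hlt 0 0)
  have := sub_pos.mpr (hlt 1 1)
  positivity

lemma kappa0_pos (hpos : ∀ i j, 0 < p i j) (hlt : ∀ i j, p i j < 1) : 0 < kappa0 p := by
  refine div_pos ?_ (kappaDenom_pos hpos hlt)
  nlinarith [hpos 1 1, hlt 1 1, sq_nonneg (p 0 1)]

lemma kappa1_pos (hpos : ∀ i j, 0 < p i j) (hlt : ∀ i j, p i j < 1) : 0 < kappa1 p := by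
  refine div_pos ?_ (kappaDenom_pos hpos hlt)
  nlinarith [hpos 0 0, hlt 0 0, sq_nonneg (p 1 0)]

lemma kappa_pos (hpos : ∀ i j, 0 < p i j) (hlt : ∀ i j, p i j < 1) : 0 < kappa μ p := by
  have := kappa0_pos hpos hlt
  have := kappa1_pos hpos hlt
  rw [kappa]
  positivity

lemma means_eq_kappa (hpos : ∀ i j, 0 < p i j) (hlt : ∀ i j, p i j < 1)
    (hps : ∀ i, p i 0 + p i 1 = 1) {m₀ m₁ : ℝ}
    (h0 : m₀ = p 0 0 ^ 2 * m₀ + (1 - p 0 0) ^ 2 * m₁ + 1)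
    (h1 : m₁ = p 1 0 ^ 2 * m₀ + (1 - p 1 0) ^ 2 * m₁ + 1) :
    m₀ = kappa0 p ∧ m₁ = kappa1 p := by
  have hD := kappaDenom_pos hpos hlt
  have e0 : p 0 1 = 1 - p 0 0 := by linarith [hps 0]
  have e1 : p 1 0 = 1 - p 1 1 := by linarith [hps 1]
  rw [kappa0, kappa1, eq_div_iff hD.ne', eq_div_iff hD.ne', kappaDenom, e0]
  rw [e1] at h1 ⊢
  set a := p 0 0
  set b := p 1 1
  constructor
  -- Cramer's rule: the multipliers are cofactors of the linear system, and its determinant `(1 - a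
  -- ^ 2) * (1 - b ^ 2) - (1 - a) ^ 2 * (1 - b) ^ 2` is `kappaDenom p`.
  · linear_combination (1 - b ^ 2) * h0 + (1 - a) ^ 2 * h1
  · linear_combination (1 - b) ^ 2 * h0 + (1 - a ^ 2) * h1

/-! ### Sources with bounded transition probabilities -/

/-- `(μ, p)` is a Markov source all of whose transition probabilities are at most `ρ < 1`. -/
structure IsSource (p : Matrix (Fin 2) (Fin 2) ℝ) (μ : Fin 2 → ℝ) (ρ : ℝ) : Prop where
  init_nonneg : ∀ i, 0 ≤ μ i
  init_sum : μ 0 + μ 1 = 1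
  nonneg : ∀ i j, 0 ≤ p i j
  sum_row : ∀ i, p i 0 + p i 1 = 1
  le_rho : ∀ i j, p i j ≤ ρ
  rho_pos : 0 < ρ
  rho_lt_one : ρ < 1

namespace IsSource

lemma init_le_one (hs : IsSource p μ ρ) (i : Fin 2) : μ i ≤ 1 := by
  have h0 := hs.init_nonneg 0
  have h1 := hs.init_nonneg 1
  have h := hs.init_sum
  revert i
  rw [Fin.forall_fin_two]
  constructor <;> linarith

lemma row (hs : IsSource p μ ρ) (i : Fin 2) : IsSource p (p i) ρ :=
  { hs with init_nonneg := hs.nonneg i, init_sum := hs.sum_row i }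

lemma prefixProb_nonneg (hs : IsSource p μ ρ) (y : Str) (k : ℕ) : 0 ≤ prefixProb p μ y k :=
  RadixSelection.prefixProb_nonneg hs.init_nonneg hs.nonneg y k

lemma prefixProb_le (hs : IsSource p μ ρ) (y : Str) (k : ℕ) :
    -- Truncated subtraction makes the bound `1` for `k = 0`, so no case is excluded.
    prefixProb p μ y k ≤ ρ ^ (k - 1) := by
  cases k with
  | zero => simp
  | succ k => exact prefixProb_succ_le hs.init_le_one hs.nonneg hs.le_rho y k

lemma summable_prefixProb (hs : IsSource p μ ρ) (y : Str) : Summable (prefixProb p μ y) :=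
  RadixSelection.summable_prefixProb hs.init_nonneg hs.init_le_one hs.nonneg hs.le_rho
    hs.rho_lt_one y

lemma pathCost_nonneg (hs : IsSource p μ ρ) (y : Str) : 0 ≤ pathCost p μ y :=
  RadixSelection.pathCost_nonneg hs.init_nonneg hs.nonneg y

lemma pathCost_le (hs : IsSource p μ ρ) (y : Str) : pathCost p μ y ≤ 1 + (1 - ρ)⁻¹ :=
  RadixSelection.pathCost_le hs.init_nonneg hs.init_le_one hs.nonneg hs.le_rho hs.rho_lt_one y

lemma measurable_pathCost (hs : IsSource p μ ρ) : Measurable (pathCost p μ) :=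
  RadixSelection.measurable_pathCost hs.init_nonneg hs.init_le_one hs.nonneg hs.le_rho
    hs.rho_lt_one

lemma map_pathCost (hs : IsSource p μ ρ) {κ : Measure Str} (h : IsChainLaw p μ κ)
    {κr : Fin 2 → Measure Str} (hr : ∀ i, IsChainLaw p (p i) (κr i)) :
    κ.map (pathCost p μ) =
      mixLaw (μ 0) ((κr 0).map (pathCost p (p 0))) ((κr 1).map (pathCost p (p 1))) :=
  RadixSelection.map_pathCost h hs.init_nonneg hs.init_sum hs.nonneg hs.le_rho hs.rho_lt_one hr

end IsSource

/-! ### The distribution of the number of shared stages -/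

lemma sharedStages_self (x : Str) : sharedStages x x = 1 := by
  simp [sharedStages, PiNat.firstDiff_def]

/-- By convention `PiNat.firstDiff` vanishes on equal strings, so the diagonal, where every prefix
agrees, has to be excluded. The threshold `0` is always exceeded and is left out. -/
lemma succ_lt_sharedStages_iff {x y : Str} {k : ℕ} :
    k + 1 < sharedStages x y ↔ x ≠ y ∧ x ∈ PiNat.cylinder y (k + 1) := by
  by_cases h : x = y
  · subst h
    simp [sharedStages_self]
  · simp only [ne_eq, h, not_false_eq_true, true_and]
    rw [mem_cylinder_iff_lt_sharedStages h]

lemma measurable_sharedStages : Measurable fun q : Str × Str => sharedStages q.1 q.2 := by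
  refine measurable_of_Ioi fun k => ?_
  cases k with
  | zero =>
    convert MeasurableSet.univ
    ext q
    simp [sharedStages]
  | succ k =>
    have : (fun q : Str × Str => sharedStages q.1 q.2) ⁻¹' Set.Ioi (k + 1) =
        (Set.diagonal Str)ᶜ ∩ ⋂ m ∈ Set.Iio (k + 1), {q : Str × Str | q.1 m = q.2 m} := by
      ext q
      simp only [Set.mem_preimage, Set.mem_Ioi, succ_lt_sharedStages_iff, Set.mem_inter_iff,
        Set.mem_compl_iff, Set.mem_diagonal_iff, PiNat.mem_cylinder_iff, Set.mem_iInter,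
        Set.mem_Iio, Set.mem_ofPred_eq, ne_eq]
    rw [this]
    refine measurableSet_diagonal.compl.inter
      (MeasurableSet.biInter (Set.to_countable _) fun m _ => ?_)
    exact measurableSet_eq_fun ((measurable_pi_apply m).comp measurable_fst)
      ((measurable_pi_apply m).comp measurable_snd)

lemma measurable_sharedStages_right (y : Str) : Measurable fun x => sharedStages x y :=
  measurable_sharedStages.comp (measurable_id.prodMk measurable_const)

lemma IsChainLaw.measure_singleton (hs : IsSource p μ ρ) {κ : Measure Str}
    (h : IsChainLaw p μ κ) (y : Str) : κ {y} = 0 := by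
  have hle : ∀ k : ℕ, κ {y} ≤ ENNReal.ofReal (ρ ^ k) := fun k => by
    calc κ {y} ≤ κ (PiNat.cylinder y (k + 1)) :=
          measure_mono (Set.singleton_subset_iff.mpr (PiNat.self_mem_cylinder y _))
      _ = ENNReal.ofReal (prefixProb p μ y (k + 1)) := h y _
      _ ≤ _ := ENNReal.ofReal_le_ofReal (hs.prefixProb_le y (k + 1))
  have hlim : Tendsto (fun k : ℕ => ENNReal.ofReal (ρ ^ k)) atTop (𝓝 0) := by
    rw [← ENNReal.ofReal_zero]
    exact ENNReal.tendsto_ofReal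
      (tendsto_pow_atTop_nhds_zero_of_lt_one hs.rho_pos.le hs.rho_lt_one)
  exact le_antisymm (ge_of_tendsto' hlim hle) bot_le

lemma IsChainLaw.measure_lt_sharedStages (hs : IsSource p μ ρ) {κ : Measure Str}
    (h : IsChainLaw p μ κ) (y : Str) (k : ℕ) :
    κ {x | k < sharedStages x y} = ENNReal.ofReal (prefixProb p μ y k) := by
  rw [← h y k]
  have hne : ∀ᵐ x ∂κ, x ≠ y := by
    rw [ae_iff]
    simpa using h.measure_singleton hs y
  refine measure_congr ?_
  filter_upwards [hne] with x hx
  exact propext (mem_cylinder_iff_lt_sharedStages hx k).symm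

/-- Layer-cake formula. Weights `1` give the mean, and weights `(k + 1) ^ m` dominate the moment of
order `m`. -/
lemma IsChainLaw.lintegral_sum_lt_sharedStages (hs : IsSource p μ ρ) {κ : Measure Str}
    (h : IsChainLaw p μ κ) (y : Str) (c : ℕ → ℝ≥0∞) :
    ∫⁻ x, ∑' k, c k * (if k < sharedStages x y then 1 else 0) ∂κ =
      ∑' k, c k * ENNReal.ofReal (prefixProb p μ y k) := by
  have hset : ∀ k, MeasurableSet {x | k < sharedStages x y} := fun k =>
    measurable_sharedStages_right y measurableSet_Ioi
  have hmeas : ∀ k, Measurable fun x : Str => if k < sharedStages x y then (1 : ℝ≥0∞) else 0 :=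
    fun k => Measurable.ite (hset k) measurable_const measurable_const
  rw [lintegral_tsum fun k => ((hmeas k).const_mul _).aemeasurable]
  refine tsum_congr fun k => ?_
  rw [lintegral_const_mul _ (hmeas k), ← h.measure_lt_sharedStages hs y k,
    ← lintegral_indicator_one (hset k)]
  congr 1
  refine lintegral_congr fun x => ?_
  simp [Set.indicator_apply]

lemma IsChainLaw.lintegral_sharedStages (hs : IsSource p μ ρ) {κ : Measure Str}
    (h : IsChainLaw p μ κ) (y : Str) :
    ∫⁻ x, (sharedStages x y : ℝ≥0∞) ∂κ = ENNReal.ofReal (pathCost p μ y) := by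
  have := h.lintegral_sum_lt_sharedStages hs y fun _ => 1
  simp only [one_mul, tsum_ite_lt] at this
  rw [this, pathCost, ENNReal.ofReal_tsum_of_nonneg (hs.prefixProb_nonneg y)
    (hs.summable_prefixProb y)]

/-- A bound for the moment of order `m` of the number of shared stages. -/
def momentBound (ρ : ℝ) (m : ℕ) : ℝ := ∑' k : ℕ, ((k : ℝ) + 1) ^ m * ρ ^ (k - 1)

lemma summable_momentBound (h0 : 0 < ρ) (h1 : ρ < 1) (m : ℕ) :
    Summable fun k : ℕ => ((k : ℝ) + 1) ^ m * ρ ^ (k - 1) := by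
  rw [← summable_nat_add_iff 1]
  have h := (summable_nat_add_iff 2).mpr (summable_pow_mul_geometric_of_norm_lt_one (R := ℝ) m
    (r := ρ) (by rwa [Real.norm_of_nonneg h0.le]))
  refine (h.mul_left (ρ ^ 2)⁻¹).congr fun k => ?_
  rw [Nat.add_sub_cancel]
  push_cast
  field_simp
  ring

lemma momentBound_nonneg (h0 : 0 < ρ) (m : ℕ) : 0 ≤ momentBound ρ m :=
  tsum_nonneg fun k => by positivity

lemma IsChainLaw.lintegral_sharedStages_pow_le (hs : IsSource p μ ρ) {κ : Measure Str}
    (h : IsChainLaw p μ κ) (y : Str) (m : ℕ) :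
    ∫⁻ x, (sharedStages x y : ℝ≥0∞) ^ m ∂κ ≤ ENNReal.ofReal (momentBound ρ m) := by
  have hpt : ∀ x, (sharedStages x y : ℝ≥0∞) ^ m ≤
      ∑' k : ℕ, ((k : ℝ≥0∞) + 1) ^ m * (if k < sharedStages x y then 1 else 0) := by
    intro x
    -- The last nonzero term of the series alone equals the power on the left.
    refine le_trans ?_ (ENNReal.le_tsum (sharedStages x y - 1))
    have : 1 ≤ sharedStages x y := by simp [sharedStages]
    rw [if_pos (by omega), mul_one]
    conv_lhs => rw [show sharedStages x y = sharedStages x y - 1 + 1 by omega]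
    push_cast
    rfl
  refine (lintegral_mono hpt).trans ?_
  rw [h.lintegral_sum_lt_sharedStages hs y, momentBound,
    ENNReal.ofReal_tsum_of_nonneg (fun k => by have := hs.rho_pos; positivity)
    (summable_momentBound hs.rho_pos hs.rho_lt_one m)]
  refine ENNReal.tsum_le_tsum fun k => ?_
  rw [ENNReal.ofReal_mul (by positivity), ENNReal.ofReal_pow (by positivity),
    ENNReal.ofReal_add (by positivity) zero_le_one, ENNReal.ofReal_natCast, ENNReal.ofReal_one]
  gcongr
  exact hs.prefixProb_le y k

lemma integrable_natCast_pow {Ω : Type*} [MeasurableSpace Ω] {P : Measure Ω} {f : Ω → ℕ}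
    (hf : Measurable f) {m : ℕ} {C : ℝ} (hC : 0 ≤ C)
    (h : ∫⁻ ω, (f ω : ℝ≥0∞) ^ m ∂P ≤ ENNReal.ofReal C) :
    Integrable (fun ω => (f ω : ℝ) ^ m) P ∧ ∫ ω, (f ω : ℝ) ^ m ∂P ≤ C := by
  have hm : Measurable fun ω => (f ω : ℝ) ^ m :=
    (Measurable.of_discrete (f := fun n : ℕ => (n : ℝ) ^ m)).comp hf
  have hnn : ∀ ω, 0 ≤ (f ω : ℝ) ^ m := fun ω => by positivity
  have he : ∀ ω, ENNReal.ofReal ((f ω : ℝ) ^ m) = (f ω : ℝ≥0∞) ^ m := fun ω => by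
    rw [ENNReal.ofReal_pow (by positivity), ENNReal.ofReal_natCast]
  constructor
  · refine ⟨hm.aestronglyMeasurable, ?_⟩
    rw [hasFiniteIntegral_iff_ofReal (Eventually.of_forall hnn)]
    simp_rw [he]
    exact h.trans_lt ENNReal.ofReal_lt_top
  · rw [integral_eq_lintegral_of_nonneg_ae (Eventually.of_forall hnn) hm.aestronglyMeasurable]
    simp_rw [he]
    exact ENNReal.toReal_le_of_le_ofReal hC h

lemma measurable_followCost {n : ℕ} (j : Fin n) :
    Measurable fun x : Fin n → Str => followCost x j := by
  have hA : ∀ i, Measurable fun x : Fin n → Str => sharedStages (x i) (x j) := fun i => by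
    have hpair : Measurable fun x : Fin n → Str => (x i, x j) :=
      (measurable_pi_apply i).prodMk (measurable_pi_apply j)
    exact measurable_sharedStages.comp hpair
  refine Measurable.add (Finset.measurable_fun_sum _ fun i _ => hA i) ?_
  induction Finset.univ.erase j using Finset.induction_on with
  | empty => exact measurable_const
  | insert i s _ ih =>
    simp only [Finset.sup_insert]
    exact (hA i).sup ih

/-! ### Moment and mean square estimates for a sample -/

/-- `X` are independent strings from the Markov source `(μ, p)`. -/
structure IsStringSample {Ω : Type*} [MeasurableSpace Ω] (P : Measure Ω)
    (p : Matrix (Fin 2) (Fin 2) ℝ) (μ : Fin 2 → ℝ) {n : ℕ} (X : Fin n → Ω → Str) : Prop where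
  measurable : ∀ i, Measurable (X i)
  isChainLaw : ∀ i, IsChainLaw p μ (P.map (X i))
  indep : iIndepFun X P

section Sample

variable {Ω : Type*} [MeasurableSpace Ω] {P : Measure Ω} {n : ℕ} {X : Fin n → Ω → Str}

namespace IsStringSample

lemma measurable_sharedStages (hX : IsStringSample P p μ X) (i j : Fin n) :
    Measurable fun ω => sharedStages (X i ω) (X j ω) :=
  RadixSelection.measurable_sharedStages.comp ((hX.measurable i).prodMk (hX.measurable j))

lemma measurable_followCost (hX : IsStringSample P p μ X) (j : Fin n) :
    Measurable fun ω => followCost (fun i => X i ω) j :=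
  (RadixSelection.measurable_followCost j).comp (measurable_pi_iff.mpr hX.measurable)

variable [IsProbabilityMeasure P]

lemma map_pair (hX : IsStringSample P p μ X) {i j : Fin n} (hij : i ≠ j) :
    P.map (fun ω => (X i ω, X j ω)) = (P.map (X i)).prod (P.map (X j)) :=
  (indepFun_iff_map_prod_eq_prod_map_map (hX.measurable i).aemeasurable
    (hX.measurable j).aemeasurable).mp (hX.indep.indepFun hij)

lemma map_triple (hX : IsStringSample P p μ X) {i i' j : Fin n} (hii : i ≠ i') (hij : i ≠ j)
    (hij' : i' ≠ j) : P.map (fun ω => ((X i ω, X i' ω), X j ω)) =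
      ((P.map (X i)).prod (P.map (X i'))).prod (P.map (X j)) := by
  rw [← hX.map_pair hii]
  exact (indepFun_iff_map_prod_eq_prod_map_map
    ((hX.measurable i).prodMk (hX.measurable i')).aemeasurable
    (hX.measurable j).aemeasurable).mp (hX.indep.indepFun_prodMk hX.measurable i i' j hij hij')

lemma sharedStages_pow (hX : IsStringSample P p μ X) (hs : IsSource p μ ρ) {i j : Fin n}
    (hij : i ≠ j) (m : ℕ) :
    Integrable (fun ω => (sharedStages (X i ω) (X j ω) : ℝ) ^ m) P ∧
      ∫ ω, (sharedStages (X i ω) (X j ω) : ℝ) ^ m ∂P ≤ momentBound ρ m := by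
  refine integrable_natCast_pow (hX.measurable_sharedStages i j)
    (momentBound_nonneg hs.rho_pos m) ?_
  have hm : Measurable fun q : Str × Str => (sharedStages q.1 q.2 : ℝ≥0∞) ^ m :=
    (Measurable.of_discrete (f := fun n : ℕ => (n : ℝ≥0∞) ^ m)).comp
      RadixSelection.measurable_sharedStages
  have := Measure.isProbabilityMeasure_map (μ := P) (hX.measurable i).aemeasurable
  have := Measure.isProbabilityMeasure_map (μ := P) (hX.measurable j).aemeasurable
  rw [← lintegral_map (f := fun q : Str × Str => (sharedStages q.1 q.2 : ℝ≥0∞) ^ m)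
    (g := fun ω => (X i ω, X j ω)) hm ((hX.measurable i).prodMk (hX.measurable j)),
    hX.map_pair hij, lintegral_prod_symm' _ hm]
  calc _ ≤ ∫⁻ _, ENNReal.ofReal (momentBound ρ m) ∂(P.map (X j)) :=
        lintegral_mono fun y => (hX.isChainLaw i).lintegral_sharedStages_pow_le hs y m
    _ = _ := by simp

end IsStringSample

lemma IsChainLaw.integral_sharedStages_sub (hs : IsSource p μ ρ) {κ : Measure Str}
    (h : IsChainLaw p μ κ) (y : Str) :
    ∫ x, ((sharedStages x y : ℝ) - pathCost p μ y) ∂κ = 0 := by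
  have := h.isProbabilityMeasure
  have hi := integrable_natCast_pow (P := κ) (m := 1) (measurable_sharedStages_right y)
    (momentBound_nonneg hs.rho_pos 1) (h.lintegral_sharedStages_pow_le hs y 1)
  simp only [pow_one] at hi
  rw [integral_sub hi.1 (integrable_const _), integral_const, probReal_univ, one_smul,
    integral_eq_lintegral_of_nonneg_ae (Eventually.of_forall fun x => Nat.cast_nonneg _)
      hi.1.aestronglyMeasurable]
  simp_rw [ENNReal.ofReal_natCast]
  rw [h.lintegral_sharedStages hs, ENNReal.toReal_ofReal (hs.pathCost_nonneg y), sub_self]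

/-- The centred number of stages shared by the strings `x` and `y`, given `y`. -/
def centred (p : Matrix (Fin 2) (Fin 2) ℝ) (μ : Fin 2 → ℝ) (x y : Str) : ℝ :=
  sharedStages x y - pathCost p μ y

lemma measurable_centred (hs : IsSource p μ ρ) :
    Measurable fun q : Str × Str => centred p μ q.1 q.2 :=
  ((Measurable.of_discrete (f := fun n : ℕ => (n : ℝ))).comp measurable_sharedStages).sub
    (hs.measurable_pathCost.comp measurable_snd)

/-- A bound for the variance of the number of shared stages. -/
def varBound (ρ : ℝ) : ℝ := 2 * momentBound ρ 2 + 2 * (1 + (1 - ρ)⁻¹) ^ 2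

lemma IsSource.pathCost_sq_le (hs : IsSource p μ ρ) (y : Str) :
    pathCost p μ y ^ 2 ≤ (1 + (1 - ρ)⁻¹) ^ 2 :=
  pow_le_pow_left₀ (hs.pathCost_nonneg y) (hs.pathCost_le y) 2

namespace IsStringSample

variable [IsProbabilityMeasure P]

lemma centred_sq (hX : IsStringSample P p μ X) (hs : IsSource p μ ρ) {i j : Fin n}
    (hij : i ≠ j) : Integrable (fun ω => centred p μ (X i ω) (X j ω) ^ 2) P ∧
      ∫ ω, centred p μ (X i ω) (X j ω) ^ 2 ∂P ≤ varBound ρ := by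
  obtain ⟨hi, hle⟩ := hX.sharedStages_pow hs hij 2
  have hm : Measurable fun ω => centred p μ (X i ω) (X j ω) :=
    (measurable_centred hs).comp ((hX.measurable i).prodMk (hX.measurable j))
  have hb : ∀ ω, centred p μ (X i ω) (X j ω) ^ 2 ≤
      2 * (sharedStages (X i ω) (X j ω) : ℝ) ^ 2 + 2 * (1 + (1 - ρ)⁻¹) ^ 2 := fun ω => by
    have := hs.pathCost_sq_le (X j ω)
    rw [centred]
    nlinarith [sq_nonneg ((sharedStages (X i ω) (X j ω) : ℝ) + pathCost p μ (X j ω))]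
  have hib : Integrable (fun ω => 2 * (sharedStages (X i ω) (X j ω) : ℝ) ^ 2 +
      2 * (1 + (1 - ρ)⁻¹) ^ 2) P := (hi.const_mul 2).add (integrable_const _)
  have hintg : Integrable (fun ω => centred p μ (X i ω) (X j ω) ^ 2) P :=
    hib.mono' (hm.pow_const 2).aestronglyMeasurable (Eventually.of_forall fun ω => by
      rw [Real.norm_of_nonneg (sq_nonneg _)]; exact hb ω)
  refine ⟨hintg, (integral_mono hintg hib hb).trans ?_⟩
  rw [integral_add (hi.const_mul 2) (integrable_const _), integral_const_mul]
  simp only [integral_const, probReal_univ, smul_eq_mul, one_mul, varBound]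
  linarith

lemma integrable_centred_mul (hX : IsStringSample P p μ X) (hs : IsSource p μ ρ)
    {i i' j : Fin n} (hij : i ≠ j) (hij' : i' ≠ j) :
    Integrable (fun ω => centred p μ (X i ω) (X j ω) * centred p μ (X i' ω) (X j ω)) P := by
  have hm : ∀ i, Measurable fun ω => centred p μ (X i ω) (X j ω) := fun i =>
    (measurable_centred hs).comp ((hX.measurable i).prodMk (hX.measurable j))
  refine ((hX.centred_sq hs hij).1.add (hX.centred_sq hs hij').1).mono'
    ((hm i).mul (hm i')).aestronglyMeasurable (Eventually.of_forall fun ω => ?_)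
  rw [Real.norm_eq_abs, abs_le]
  constructor <;> simp only [Pi.add_apply] <;>
    nlinarith [sq_nonneg (centred p μ (X i ω) (X j ω) + centred p μ (X i' ω) (X j ω)),
      sq_nonneg (centred p μ (X i ω) (X j ω) - centred p μ (X i' ω) (X j ω)),
      sq_nonneg (centred p μ (X i ω) (X j ω)), sq_nonneg (centred p μ (X i' ω) (X j ω))]

/-- Given string `j`, the two factors are independent, and each is centred at its conditional mean.
This orthogonality makes the second moment of the centred sum linear in `n`. -/
lemma integral_centred_mul (hX : IsStringSample P p μ X) (hs : IsSource p μ ρ)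
    {i i' j : Fin n} (hii : i ≠ i') (hij : i ≠ j) (hij' : i' ≠ j) :
    ∫ ω, centred p μ (X i ω) (X j ω) * centred p μ (X i' ω) (X j ω) ∂P = 0 := by
  set F : (Str × Str) × Str → ℝ := fun q => centred p μ q.1.1 q.2 * centred p μ q.1.2 q.2 with hF
  have hc := measurable_centred hs
  have hFm : Measurable F :=
    (hc.comp ((measurable_fst.comp measurable_fst).prodMk measurable_snd)).mul
      (hc.comp ((measurable_snd.comp measurable_fst).prodMk measurable_snd))
  have hg : Measurable fun ω => ((X i ω, X i' ω), X j ω) :=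
    ((hX.measurable i).prodMk (hX.measurable i')).prodMk (hX.measurable j)
  have := fun i => Measure.isProbabilityMeasure_map (μ := P) (hX.measurable i).aemeasurable
  have hFi : Integrable F (P.map fun ω => ((X i ω, X i' ω), X j ω)) :=
    (integrable_map_measure hFm.aestronglyMeasurable hg.aemeasurable).mpr
      (hX.integrable_centred_mul hs hij hij')
  rw [← integral_map (f := F) hg.aemeasurable hFm.aestronglyMeasurable]
  rw [hX.map_triple hii hij hij'] at hFi ⊢
  rw [integral_prod_symm _ hFi]
  have hz : ∀ y, ∫ q, F (q, y) ∂((P.map (X i)).prod (P.map (X i'))) = 0 := fun y => by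
    simp only [hF]
    rw [integral_prod_mul (fun x => centred p μ x y) (fun x => centred p μ x y)]
    simp only [centred]
    rw [(hX.isChainLaw i).integral_sharedStages_sub hs, zero_mul]
  simp [hz]

lemma integral_sum_centred_sq_le (hX : IsStringSample P p μ X) (hs : IsSource p μ ρ)
    (j : Fin n) :
    Integrable (fun ω => (∑ i ∈ Finset.univ.erase j, centred p μ (X i ω) (X j ω)) ^ 2) P ∧
      ∫ ω, (∑ i ∈ Finset.univ.erase j, centred p μ (X i ω) (X j ω)) ^ 2 ∂P ≤ n * varBound ρ := by
  have hv : 0 ≤ varBound ρ := by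
    have := momentBound_nonneg hs.rho_pos 2
    rw [varBound]; positivity
  have hne : ∀ i ∈ Finset.univ.erase j, i ≠ j := fun i hi => (Finset.mem_erase.mp hi).1
  simp_rw [sq, Finset.sum_mul_sum]
  refine ⟨integrable_finsetSum _ fun i hi => integrable_finsetSum _ fun i' hi' =>
    hX.integrable_centred_mul hs (hne i hi) (hne i' hi'), ?_⟩
  rw [integral_finsetSum _ fun i hi => integrable_finsetSum _ fun i' hi' =>
    hX.integrable_centred_mul hs (hne i hi) (hne i' hi')]
  calc _ = ∑ i ∈ Finset.univ.erase j, ∫ ω, centred p μ (X i ω) (X j ω) ^ 2 ∂P := by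
        refine Finset.sum_congr rfl fun i hi => ?_
        rw [integral_finsetSum _ fun i' hi' =>
          hX.integrable_centred_mul hs (hne i hi) (hne i' hi'), Finset.sum_eq_single_of_mem i hi]
        · simp_rw [sq]
        · exact fun i' hi' h => hX.integral_centred_mul hs h.symm (hne i hi) (hne i' hi')
    _ ≤ ∑ i ∈ Finset.univ.erase j, varBound ρ :=
        Finset.sum_le_sum fun i hi => (hX.centred_sq hs (hne i hi)).2
    _ ≤ n * varBound ρ := by
        rw [Finset.sum_const, nsmul_eq_mul]
        gcongr
        exact (Finset.card_le_univ _).trans (by simp)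

end IsStringSample

lemma followCost_le {n : ℕ} (x : Fin n → Str) (j : Fin n) :
    followCost x j ≤ 2 * ∑ i ∈ Finset.univ.erase j, sharedStages (x i) (x j) := by
  rw [followCost, two_mul]
  gcongr
  exact Finset.sup_le fun i hi => Finset.single_le_sum
    (f := fun i => sharedStages (x i) (x j)) (fun _ _ => Nat.zero_le _) hi

/-- The crude bound suffices: its mean is `O(n)`, negligible after division by `n ^ 2`. -/
lemma sup_sharedStages_sq_le {n : ℕ} (x : Fin n → Str) (j : Fin n) :
    (((Finset.univ.erase j).sup fun i => sharedStages (x i) (x j) : ℕ) : ℝ) ^ 2 ≤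
      ∑ i ∈ Finset.univ.erase j, (sharedStages (x i) (x j) : ℝ) ^ 2 := by
  rcases (Finset.univ.erase j).eq_empty_or_nonempty with h | h
  · simp [h]
  · obtain ⟨i, hi, he⟩ := Finset.exists_mem_eq_sup _ h fun i => sharedStages (x i) (x j)
    rw [he]
    exact Finset.single_le_sum (f := fun i => (sharedStages (x i) (x j) : ℝ) ^ 2)
      (fun _ _ => sq_nonneg _) hi

lemma followCost_sub_sq_le {n : ℕ} (x : Fin n → Str) (j : Fin n) :
    ((followCost x j : ℝ) - n * pathCost p μ (x j)) ^ 2 ≤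
      3 * (∑ i ∈ Finset.univ.erase j, centred p μ (x i) (x j)) ^ 2 +
      3 * ∑ i ∈ Finset.univ.erase j, (sharedStages (x i) (x j) : ℝ) ^ 2 +
      3 * pathCost p μ (x j) ^ 2 := by
  have hcard : ((Finset.univ.erase j).card : ℝ) = n - 1 := by
    rw [Finset.card_erase_of_mem (Finset.mem_univ j), Finset.card_univ, Fintype.card_fin,
      Nat.cast_sub (by have := j.pos; omega), Nat.cast_one]
  have h := sup_sharedStages_sq_le x j
  -- Only `n - 1` strings accompany `j`, whence the leftover `pathCost` term. The claim is then `(a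
  -- + b - c) ^ 2 ≤ 3 * (a ^ 2 + b ^ 2 + c ^ 2)`.
  have e : (followCost x j : ℝ) - n * pathCost p μ (x j) =
      ∑ i ∈ Finset.univ.erase j, centred p μ (x i) (x j) +
      ((Finset.univ.erase j).sup fun i => sharedStages (x i) (x j) : ℕ) -
      pathCost p μ (x j) := by
    simp only [centred, followCost, Finset.sum_sub_distrib, Finset.sum_const, nsmul_eq_mul, hcard]
    push_cast
    ring
  rw [e]
  generalize ∑ i ∈ Finset.univ.erase j, centred p μ (x i) (x j) = a at *
  generalize pathCost p μ (x j) = c at *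
  generalize (((Finset.univ.erase j).sup fun i => sharedStages (x i) (x j) : ℕ) : ℝ) = b at *
  nlinarith [sq_nonneg (a - b), sq_nonneg (a + c), sq_nonneg (b + c)]

/-- The constant in the mean square bound for the normalized cost. -/
def errorBound (ρ : ℝ) : ℝ :=
  3 * varBound ρ + 3 * momentBound ρ 2 + 3 * (1 + (1 - ρ)⁻¹) ^ 2

namespace IsStringSample

variable [IsProbabilityMeasure P]

lemma integral_error_le (hX : IsStringSample P p μ X) (hs : IsSource p μ ρ) (j : Fin n) :
    Integrable (fun ω => ((followCost (fun i => X i ω) j : ℝ) / n - pathCost p μ (X j ω)) ^ 2) P ∧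
    ∫ ω, ((followCost (fun i => X i ω) j : ℝ) / n - pathCost p μ (X j ω)) ^ 2 ∂P ≤
      errorBound ρ / n := by
  have hn : (1 : ℝ) ≤ n := by exact_mod_cast j.pos
  have hne : ∀ i ∈ Finset.univ.erase j, i ≠ j := fun i hi => (Finset.mem_erase.mp hi).1
  obtain ⟨h1, h1'⟩ := hX.integral_sum_centred_sq_le hs j
  have h2 : Integrable (fun ω => ∑ i ∈ Finset.univ.erase j,
      (sharedStages (X i ω) (X j ω) : ℝ) ^ 2) P :=
    integrable_finsetSum _ fun i hi => (hX.sharedStages_pow hs (hne i hi) 2).1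
  have h2' : ∫ ω, ∑ i ∈ Finset.univ.erase j, (sharedStages (X i ω) (X j ω) : ℝ) ^ 2 ∂P ≤
      n * momentBound ρ 2 := by
    rw [integral_finsetSum _ fun i hi => (hX.sharedStages_pow hs (hne i hi) 2).1]
    calc _ ≤ ∑ i ∈ Finset.univ.erase j, momentBound ρ 2 :=
          Finset.sum_le_sum fun i hi => (hX.sharedStages_pow hs (hne i hi) 2).2
      _ ≤ n * momentBound ρ 2 := by
          rw [Finset.sum_const, nsmul_eq_mul]
          gcongr
          · exact momentBound_nonneg hs.rho_pos 2
          · exact (Finset.card_le_univ _).trans (by simp)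
  set G : Ω → ℝ := fun ω => (3 * (∑ i ∈ Finset.univ.erase j, centred p μ (X i ω) (X j ω)) ^ 2 +
      3 * ∑ i ∈ Finset.univ.erase j, (sharedStages (X i ω) (X j ω) : ℝ) ^ 2 +
      3 * (1 + (1 - ρ)⁻¹) ^ 2) / n ^ 2 with hG
  have hGi : Integrable G P :=
    (((h1.const_mul 3).add (h2.const_mul 3)).add (integrable_const _)).div_const _
  have hle : ∀ ω, ((followCost (fun i => X i ω) j : ℝ) / n - pathCost p μ (X j ω)) ^ 2 ≤ G ω := by
    intro ω
    have e : (followCost (fun i => X i ω) j : ℝ) / n - pathCost p μ (X j ω) =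
        ((followCost (fun i => X i ω) j : ℝ) - n * pathCost p μ (X j ω)) / n := by
      field_simp
    rw [e, div_pow]
    simp only [hG]
    gcongr
    have a := followCost_sub_sq_le (p := p) (μ := μ) (fun i => X i ω) j
    have b := hs.pathCost_sq_le (X j ω)
    linarith
  have hm : Measurable fun ω =>
      ((followCost (fun i => X i ω) j : ℝ) / n - pathCost p μ (X j ω)) ^ 2 := by
    refine Measurable.pow_const (Measurable.sub ?_ ?_) 2
    · exact (((Measurable.of_discrete (f := fun n : ℕ => (n : ℝ))).comp
        (hX.measurable_followCost j))).div_const _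
    · exact hs.measurable_pathCost.comp (hX.measurable j)
  have hi := hGi.mono' hm.aestronglyMeasurable (Eventually.of_forall fun ω => by
    rw [Real.norm_of_nonneg (sq_nonneg _)]; exact hle ω)
  refine ⟨hi, (integral_mono hi hGi hle).trans ?_⟩
  have h12 : Integrable (fun ω =>
      3 * (∑ i ∈ Finset.univ.erase j, centred p μ (X i ω) (X j ω)) ^ 2 +
      3 * ∑ i ∈ Finset.univ.erase j, (sharedStages (X i ω) (X j ω) : ℝ) ^ 2) P :=
    (h1.const_mul 3).add (h2.const_mul 3)
  rw [hG, integral_div, integral_add h12 (integrable_const _),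
    integral_add (h1.const_mul 3) (h2.const_mul 3), integral_const_mul, integral_const_mul,
    integral_const, probReal_univ, one_smul]
  rw [div_le_div_iff₀ (by positivity) (by positivity), errorBound]
  have hB : 0 ≤ (1 + (1 - ρ)⁻¹) ^ 2 := sq_nonneg _
  have : 3 * ∫ ω, (∑ i ∈ Finset.univ.erase j, centred p μ (X i ω) (X j ω)) ^ 2 ∂P +
      3 * ∫ ω, ∑ i ∈ Finset.univ.erase j, (sharedStages (X i ω) (X j ω) : ℝ) ^ 2 ∂P +
      3 * (1 + (1 - ρ)⁻¹) ^ 2 ≤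
      (3 * varBound ρ + 3 * momentBound ρ 2 + 3 * (1 + (1 - ρ)⁻¹) ^ 2) * n := by
    nlinarith
  calc _ ≤ (3 * varBound ρ + 3 * momentBound ρ 2 + 3 * (1 + (1 - ρ)⁻¹) ^ 2) * n * n := by
        gcongr
    _ = _ := by ring

/-- The cost is at most twice the sum of shared stages, and the power mean inequality bounds the
power of that sum by a sum of powers. The bound does not depend on `n`; its summand `1` settles `m =
0`. -/
lemma integral_followCost_pow_le (hX : IsStringSample P p μ X) (hs : IsSource p μ ρ) (j : Fin n)
    (m : ℕ) : Integrable (fun ω => ((followCost (fun i => X i ω) j : ℝ) / n) ^ m) P ∧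
    ∫ ω, ((followCost (fun i => X i ω) j : ℝ) / n) ^ m ∂P ≤ 2 ^ m * momentBound ρ m + 1 := by
  have hM := momentBound_nonneg hs.rho_pos
  rcases m with _ | m
  · have := hM 0
    simpa using this
  have hn : (1 : ℝ) ≤ n := by exact_mod_cast j.pos
  have hne : ∀ i ∈ Finset.univ.erase j, i ≠ j := fun i hi => (Finset.mem_erase.mp hi).1
  have hcard : ((Finset.univ.erase j).card : ℝ) ≤ n := by
    exact_mod_cast (Finset.card_le_univ _).trans (by simp)
  have hci : ∀ i ∈ Finset.univ.erase j,
      Integrable (fun ω => (sharedStages (X i ω) (X j ω) : ℝ) ^ (m + 1)) P :=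
    fun i hi => (hX.sharedStages_pow hs (hne i hi) (m + 1)).1
  set G : Ω → ℝ := fun ω => 2 ^ (m + 1) / n *
    ∑ i ∈ Finset.univ.erase j, (sharedStages (X i ω) (X j ω) : ℝ) ^ (m + 1) with hG
  have hGi : Integrable G P := (integrable_finsetSum _ hci).const_mul _
  have hle : ∀ ω, ((followCost (fun i => X i ω) j : ℝ) / n) ^ (m + 1) ≤ G ω := by
    intro ω
    set S : ℝ := ∑ i ∈ Finset.univ.erase j, (sharedStages (X i ω) (X j ω) : ℝ) with hSdef
    set T : ℝ := ∑ i ∈ Finset.univ.erase j, (sharedStages (X i ω) (X j ω) : ℝ) ^ (m + 1) with hT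
    have hS0 : 0 ≤ S := Finset.sum_nonneg fun _ _ => Nat.cast_nonneg _
    have hT0 : 0 ≤ T := Finset.sum_nonneg fun _ _ => by positivity
    have hV : (followCost (fun i => X i ω) j : ℝ) ≤ 2 * S := by
      rw [hSdef]
      exact_mod_cast followCost_le (fun i => X i ω) j
    have hS : S ^ (m + 1) ≤ n ^ m * T := by
      rcases (Finset.univ.erase j).eq_empty_or_nonempty with h | h
      · have : S = 0 := by rw [hSdef, h, Finset.sum_empty]
        rw [this, zero_pow (by omega)]
        positivity
      · have := pow_sum_div_card_le_sum_pow (s := Finset.univ.erase j)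
          (f := fun i => (sharedStages (X i ω) (X j ω) : ℝ)) (fun _ _ => Nat.cast_nonneg _) m
        have hc : (0 : ℝ) < (Finset.univ.erase j).card := by exact_mod_cast h.card_pos
        rw [div_le_iff₀ (by positivity)] at this
        calc S ^ (m + 1) ≤ T * (Finset.univ.erase j).card ^ m := this
          _ ≤ T * n ^ m := by gcongr
          _ = _ := mul_comm _ _
    calc ((followCost (fun i => X i ω) j : ℝ) / n) ^ (m + 1) ≤ (2 * S / n) ^ (m + 1) := by gcongr
      _ = 2 ^ (m + 1) / n ^ (m + 1) * S ^ (m + 1) := by rw [div_pow, mul_pow]; ring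
      _ ≤ 2 ^ (m + 1) / n ^ (m + 1) * (n ^ m * T) := by gcongr
      _ = G ω := by simp only [hG, hT, pow_succ (n : ℝ)]; field_simp
  have hm : Measurable fun ω => ((followCost (fun i => X i ω) j : ℝ) / n) ^ (m + 1) :=
    (((Measurable.of_discrete (f := fun n : ℕ => (n : ℝ))).comp
      (hX.measurable_followCost j)).div_const _).pow_const _
  have hi := hGi.mono' hm.aestronglyMeasurable (Eventually.of_forall fun ω => by
    rw [Real.norm_of_nonneg (by positivity)]; exact hle ω)
  refine ⟨hi, (integral_mono hi hGi hle).trans ?_⟩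
  rw [hG, integral_const_mul, integral_finsetSum _ hci]
  calc _ ≤ 2 ^ (m + 1) / n * ∑ i ∈ Finset.univ.erase j, momentBound ρ (m + 1) := by
        gcongr with i hi
        exact (hX.sharedStages_pow hs (hne i hi) (m + 1)).2
    _ ≤ 2 ^ (m + 1) / n * (n * momentBound ρ (m + 1)) := by
        rw [Finset.sum_const, nsmul_eq_mul]
        gcongr
        exact hM _
    _ = 2 ^ (m + 1) * momentBound ρ (m + 1) := by field_simp
    _ ≤ _ := by linarith

end IsStringSample

end Sample

/-! ### Measurability, exchangeability and distinctness -/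

lemma measurableSet_state {n : ℕ} (k : ℕ) (S : Set (Finset (Fin n) × ℕ)) :
    MeasurableSet {q : (Fin n → Str) × ℕ | state q.1 q.2 k ∈ S} := by
  induction k generalizing S with
  | zero =>
    exact measurable_snd
      (MeasurableSet.of_discrete (s := {ℓ : ℕ | ((Finset.univ : Finset (Fin n)), ℓ) ∈ S}))
  | succ k ih =>
    have h : {q : (Fin n → Str) × ℕ | state q.1 q.2 (k + 1) ∈ S} =
        ⋃ s, {q : (Fin n → Str) × ℕ | state q.1 q.2 k ∈ ({s} : Set (Finset (Fin n) × ℕ))} ∩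
          {q : (Fin n → Str) × ℕ | step q.1 k s ∈ S} := by
      ext q
      simp [state_succ]
    rw [h]
    refine MeasurableSet.iUnion fun s => (ih _).inter ?_
    -- Once the countably many previous states are separated, stage `k` depends only on this column
    -- of digits, which lies in a finite discrete space.
    have hcol : Measurable fun q : (Fin n → Str) × ℕ => fun i => q.1 i k :=
      measurable_pi_iff.mpr fun i =>
        (measurable_pi_apply k).comp ((measurable_pi_apply i).comp measurable_fst)
    exact hcol (MeasurableSet.of_discrete
      (s := {c : Fin n → Fin 2 | step (fun i _ => c i) k s ∈ S}))

lemma measurable_bucketOps {n : ℕ} :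
    Measurable fun q : (Fin n → Str) × ℕ => bucketOps q.1 q.2 := by
  refine Measurable.tsum fun k => fun t _ => ?_
  exact measurableSet_state k {s | (if 2 ≤ s.1.card then (s.1.card : ℝ≥0∞) else 0) ∈ t}

lemma followCost_comp_perm {n : ℕ} (x : Fin n → Str) (e : Equiv.Perm (Fin n)) (j : Fin n) :
    followCost (fun i => x (e i)) j = followCost x (e j) := by
  have h : Finset.univ.erase (e j) = (Finset.univ.erase j).map e.toEmbedding := by
    rw [Finset.map_erase, Finset.map_univ_equiv]
    rfl
  rw [followCost, followCost, h, Finset.sum_map, Finset.sup_map]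
  rfl

lemma map_pi_perm {n : ℕ} (κ : Measure Str) [IsProbabilityMeasure κ] (e : Equiv.Perm (Fin n)) :
    (Measure.pi fun _ : Fin n => κ).map (fun x i => x (e i)) = Measure.pi fun _ => κ := by
  symm
  refine Measure.pi_eq fun s hs => ?_
  have hm : Measurable fun (x : Fin n → Str) i => x (e i) :=
    measurable_pi_iff.mpr fun i => measurable_pi_apply (e i)
  rw [Measure.map_apply hm (MeasurableSet.univ_pi hs)]
  have : (fun (x : Fin n → Str) i => x (e i)) ⁻¹' Set.univ.pi s =
      Set.univ.pi fun i => s (e.symm i) := by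
    ext x
    simp only [Set.mem_preimage, Set.mem_univ_pi]
    exact ⟨fun h i => by simpa using h (e.symm i), fun h i => by simpa using h (e i)⟩
  rw [this, Measure.pi_pi]
  exact Equiv.prod_comp e.symm fun i => κ (s i)

section Sample

variable {Ω : Type*} [MeasurableSpace Ω] {P : Measure Ω} [IsProbabilityMeasure P] {n : ℕ}
  {X : Fin n → Ω → Str}

/-- The law of a string has no atoms, so two independent strings almost surely differ. -/
lemma IsStringSample.ae_injective (hX : IsStringSample P p μ X) (hs : IsSource p μ ρ) :
    ∀ᵐ ω ∂P, Function.Injective fun i => X i ω := by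
  have hne : ∀ i j, i ≠ j → ∀ᵐ ω ∂P, X i ω ≠ X j ω := by
    intro i j hij
    have hm := (hX.measurable i).prodMk (hX.measurable j)
    have := fun i => Measure.isProbabilityMeasure_map (μ := P) (hX.measurable i).aemeasurable
    have h0 : P.map (fun ω => (X i ω, X j ω)) (Set.diagonal Str) = 0 := by
      rw [hX.map_pair hij, Measure.measure_prod_null measurableSet_diagonal]
      refine Eventually.of_forall fun x => ?_
      have : Prod.mk x ⁻¹' Set.diagonal Str = {x} := by
        ext y
        simp [eq_comm]
      simp only [this]
      exact (hX.isChainLaw j).measure_singleton hs x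
    rw [Measure.map_apply hm measurableSet_diagonal] at h0
    rw [ae_iff]
    simpa [Set.preimage] using h0
  have hall : ∀ᵐ ω ∂P, ∀ i j, i ≠ j → X i ω ≠ X j ω := by
    rw [ae_all_iff]
    intro i
    rw [ae_all_iff]
    intro j
    by_cases hij : i = j
    · simp [hij]
    · filter_upwards [hne i j hij] with ω hω _ using hω
  filter_upwards [hall] with ω hω i j hij
  by_contra h
  exact hω i j h hij

lemma IsStringSample.map_eq_pi (hX : IsStringSample P p μ X) {κ : Measure Str}
    (hκ : IsChainLaw p μ κ) : P.map (fun ω i => X i ω) = Measure.pi fun _ => κ := by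
  rw [(iIndepFun_iff_map_fun_eq_pi_map fun i => (hX.measurable i).aemeasurable).mp hX.indep]
  congr 1
  funext i
  exact (hX.isChainLaw i).unique hκ

/-- The joint law is a power of one measure, hence invariant under swapping `i` and `j`. -/
lemma IsStringSample.lintegral_followCost_eq (hX : IsStringSample P p μ X) (i j : Fin n)
    {F : ℝ≥0∞ → ℝ≥0∞} (hF : Measurable F) :
    ∫⁻ ω, F (followCost (fun i => X i ω) i) ∂P = ∫⁻ ω, F (followCost (fun i => X i ω) j) ∂P := by
  have := (hX.isChainLaw i).isProbabilityMeasure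
  have hmX : Measurable fun ω i => X i ω := measurable_pi_iff.mpr hX.measurable
  have hm : ∀ j, Measurable fun x : Fin n → Str => F (followCost x j) := fun j =>
    hF.comp ((Measurable.of_discrete (f := fun n : ℕ => (n : ℝ≥0∞))).comp
      (RadixSelection.measurable_followCost j))
  have hpi := hX.map_eq_pi (hX.isChainLaw i)
  rw [← lintegral_map (hm i) hmX, ← lintegral_map (hm j) hmX, hpi,
    ← map_pi_perm _ (Equiv.swap i j), lintegral_map (hm i)
    (measurable_pi_iff.mpr fun i => measurable_pi_apply _), map_pi_perm]
  simp_rw [followCost_comp_perm, Equiv.swap_apply_left]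

end Sample

/-! ### From a uniform rank to a fixed string -/

section Model

variable {Ω : Type*} [MeasurableSpace Ω] {P : Measure Ω} [IsProbabilityMeasure P] {n : ℕ}
  {X : Fin n → Ω → Str} {R : Ω → ℕ}

lemma IsUniformRankModel.isStringSample (h : IsUniformRankModel P μ p n X R) :
    IsStringSample P p μ X :=
  ⟨h.measurable_data, fun i => (h.markov_data i).isChainLaw (h.measurable_data i), h.indep_data⟩

lemma IsUniformRankModel.lintegral_rank (h : IsUniformRankModel P μ p n X R) (hn : 0 < n)
    (f : ℕ → ℝ≥0∞) :
    ∫⁻ ℓ, f ℓ ∂(P.map R) = (n : ℝ≥0∞)⁻¹ * ∑ ℓ ∈ Finset.Icc 1 n, f ℓ := by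
  have := Measure.isProbabilityMeasure_map (μ := P) h.measurable_rank.aemeasurable
  have hsing : ∀ ℓ ∈ Finset.Icc 1 n, P.map R {ℓ} = (n : ℝ≥0∞)⁻¹ := fun ℓ hℓ => by
    rw [Measure.map_apply h.measurable_rank (measurableSet_singleton ℓ), ← h.uniform_rank ℓ hℓ]
    rfl
  have hone : P.map R (Finset.Icc 1 n : Finset ℕ) = 1 := by
    rw [← sum_measure_singleton, Finset.sum_congr rfl hsing]
    simp only [Finset.sum_const, Nat.card_Icc, Nat.add_sub_cancel, nsmul_eq_mul]
    exact ENNReal.mul_inv_cancel (by exact_mod_cast hn.ne') (ENNReal.natCast_ne_top n)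
  -- The `n` prescribed masses already add up to `1`.
  have hzero : ∀ ℓ ∉ Finset.Icc 1 n, P.map R {ℓ} = 0 := fun ℓ hℓ => by
    refine measure_mono_null (t := ((Finset.Icc 1 n : Finset ℕ) : Set ℕ)ᶜ) ?_
      ((prob_compl_eq_zero_iff MeasurableSet.of_discrete).mpr hone)
    simpa using hℓ
  rw [lintegral_countable', tsum_eq_sum (s := Finset.Icc 1 n) fun ℓ hℓ => by
    rw [hzero ℓ hℓ, mul_zero], Finset.mul_sum]
  exact Finset.sum_congr rfl fun ℓ hℓ => by rw [hsing ℓ hℓ, mul_comm]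

/-- Selecting a uniformly distributed rank costs as much, in law, as following one string. -/
lemma IsUniformRankModel.map_bucketOps (h : IsUniformRankModel P μ p n X R)
    (hs : IsSource p μ ρ) (j : Fin n) :
    P.map (fun ω => bucketOps (fun i => X i ω) (R ω)) =
      P.map (fun ω => (followCost (fun i => X i ω) j : ℝ≥0∞)) := by
  have hn : 0 < n := j.pos
  have hX := h.isStringSample
  have hmX : Measurable fun ω i => X i ω := measurable_pi_iff.mpr hX.measurable
  have hcast : Measurable fun n : ℕ => (n : ℝ≥0∞) := Measurable.of_discrete
  have hmV : ∀ j, Measurable fun ω => (followCost (fun i => X i ω) j : ℝ≥0∞) := fun j =>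
    hcast.comp (hX.measurable_followCost j)
  have hmXR : Measurable fun ω => ((fun i => X i ω), R ω) := hmX.prodMk h.measurable_rank
  have hprod := (indepFun_iff_map_prod_eq_prod_map_map hmX.aemeasurable
    h.measurable_rank.aemeasurable).mp h.indep_rank
  have := Measure.isProbabilityMeasure_map (μ := P) h.measurable_rank.aemeasurable
  have hmW : Measurable fun ω => bucketOps (fun i => X i ω) (R ω) := measurable_bucketOps.comp hmXR
  refine Measure.ext_of_lintegral _ fun F hF => ?_
  rw [lintegral_map hF hmW, lintegral_map hF (hmV j)]
  have hFb : Measurable fun q : (Fin n → Str) × ℕ => F (bucketOps q.1 q.2) :=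
    hF.comp measurable_bucketOps
  rw [← lintegral_map (f := fun q : (Fin n → Str) × ℕ => F (bucketOps q.1 q.2)) hFb hmXR, hprod,
    lintegral_prod _ hFb.aemeasurable]
  simp_rw [h.lintegral_rank hn]
  have hFl : ∀ ℓ, Measurable fun x : Fin n → Str => F (bucketOps x ℓ) := fun ℓ =>
    hFb.comp (measurable_id.prodMk measurable_const)
  rw [lintegral_map ((Finset.measurable_fun_sum _ fun ℓ _ => hFl ℓ).const_mul _) hmX]
  have hmF : ∀ i, Measurable fun ω => F (followCost (fun i => X i ω) i) := fun i =>
    hF.comp (hmV i)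
  -- The average over ranks is an average over followed strings; by exchangeability all its terms
  -- have the same mean.
  calc _ = ∫⁻ ω, (n : ℝ≥0∞)⁻¹ * ∑ i, F (followCost (fun i => X i ω) i) ∂P := by
        refine lintegral_congr_ae ?_
        filter_upwards [hX.ae_injective hs] with ω hω
        rw [sum_bucketOps hω]
    _ = (n : ℝ≥0∞)⁻¹ * ∑ i, ∫⁻ ω, F (followCost (fun i => X i ω) i) ∂P := by
        rw [lintegral_const_mul _ (Finset.measurable_fun_sum _ fun i _ => hmF i),
          lintegral_finsetSum _ fun i _ => hmF i]
    _ = (n : ℝ≥0∞)⁻¹ * ∑ _i : Fin n, ∫⁻ ω, F (followCost (fun i => X i ω) j) ∂P := by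
        congr 1
        exact Finset.sum_congr rfl fun i _ => hX.lintegral_followCost_eq i j hF
    _ = _ := by
        rw [Finset.sum_const, Finset.card_univ, Fintype.card_fin, nsmul_eq_mul, ← mul_assoc,
          ENNReal.inv_mul_cancel (by exact_mod_cast hn.ne') (ENNReal.natCast_ne_top n), one_mul]

end Model

/-! ### Comparison of the normalized cost with its limit -/

/-- Two variables that are close in mean square have close `g`-means, if `g` is Lipschitz with a
factor `h` whose square is integrable. -/
lemma abs_integral_sub_le_of_sq {Ω : Type*} [MeasurableSpace Ω] {P : Measure Ω} {T Z h H : Ω → ℝ}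
    {g : ℝ → ℝ} {n : ℕ} (hn : 0 < n) {C D : ℝ} (hTZ : Integrable (fun ω => (T ω - Z ω) ^ 2) P)
    (hC : ∫ ω, (T ω - Z ω) ^ 2 ∂P ≤ C / n) (hH : Integrable H P) (hD : ∫ ω, H ω ∂P ≤ D)
    (hgT : Integrable (fun ω => g (T ω)) P) (hgZ : Integrable (fun ω => g (Z ω)) P)
    (hh : ∀ ω, h ω ^ 2 ≤ H ω) (hg : ∀ ω, |g (T ω) - g (Z ω)| ≤ |T ω - Z ω| * h ω) :
    |∫ ω, g (T ω) ∂P - ∫ ω, g (Z ω) ∂P| ≤ (C + D) / √n := by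
  have hs : 0 < √(n : ℝ) := Real.sqrt_pos.mpr (by exact_mod_cast hn)
  have hsq : √(n : ℝ) ^ 2 = n := Real.sq_sqrt (Nat.cast_nonneg n)
  set s := √(n : ℝ)
  rw [← integral_sub hgT hgZ]
  calc |∫ ω, (g (T ω) - g (Z ω)) ∂P| ≤ ∫ ω, |g (T ω) - g (Z ω)| ∂P := abs_integral_le_integral_abs
    -- Weighted arithmetic-geometric mean inequality. The weight `s = √n` balances a squared error
    -- of order `1 / n` against a bounded mean of `H`.
    _ ≤ ∫ ω, (s * (T ω - Z ω) ^ 2 + s⁻¹ * H ω) ∂P := by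
        refine integral_mono (hgT.sub hgZ).abs ((hTZ.const_mul s).add (hH.const_mul s⁻¹))
          fun ω => (hg ω).trans ?_
        have h1 : s⁻¹ * h ω ^ 2 ≤ s⁻¹ * H ω := by gcongr; exact hh ω
        have h2 : 0 ≤ s * (|T ω - Z ω| - s⁻¹ * h ω / 2) ^ 2 := by positivity
        have h3 : s * (|T ω - Z ω| - s⁻¹ * h ω / 2) ^ 2 =
            s * (T ω - Z ω) ^ 2 - |T ω - Z ω| * h ω + s⁻¹ * h ω ^ 2 / 4 := by
          rw [← sq_abs (T ω - Z ω)]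
          field_simp
          ring
        have h4 : 0 ≤ s⁻¹ * h ω ^ 2 := by positivity
        linarith
    _ = s * ∫ ω, (T ω - Z ω) ^ 2 ∂P + s⁻¹ * ∫ ω, H ω ∂P := by
        rw [integral_add (hTZ.const_mul s) (hH.const_mul s⁻¹), integral_const_mul,
          integral_const_mul]
    _ ≤ s * (C / n) + s⁻¹ * D := by gcongr
    _ = (C + D) / s := by rw [← hsq]; field_simp

lemma bucketOps_zero (x : Fin 0 → Str) (ℓ : ℕ) : bucketOps x ℓ = 0 := by
  simp [bucketOps, Finset.eq_empty_of_isEmpty]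

section Model

variable {Ω : Type*} [MeasurableSpace Ω] {P : Measure Ω} {n : ℕ} {X : Fin n → Ω → Str} {R : Ω → ℕ}

namespace IsUniformRankModel

lemma measurable_bucketOps (h : IsUniformRankModel P μ p n X R) :
    Measurable fun ω => bucketOps (fun i => X i ω) (R ω) :=
  RadixSelection.measurable_bucketOps.comp
    ((measurable_pi_iff.mpr h.measurable_data).prodMk h.measurable_rank)

variable [IsProbabilityMeasure P]

lemma measurable_followCost_cast (h : IsUniformRankModel P μ p n X R) (j : Fin n) :
    Measurable fun ω => (followCost (fun i => X i ω) j : ℝ≥0∞) :=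
  (Measurable.of_discrete (f := fun n : ℕ => (n : ℝ≥0∞))).comp
    (h.isStringSample.measurable_followCost j)

lemma integral_bucketOps (h : IsUniformRankModel P μ p n X R) (hs : IsSource p μ ρ)
    (j : Fin n) {g : ℝ → ℝ} (hg : Measurable g) :
    ∫ ω, g ((bucketOps (fun i => X i ω) (R ω)).toReal / n) ∂P =
      ∫ ω, g ((followCost (fun i => X i ω) j : ℝ) / n) ∂P := by
  have hm : Measurable fun w : ℝ≥0∞ => g (w.toReal / n) :=
    hg.comp (ENNReal.measurable_toReal.div_const _)
  rw [← integral_map (f := fun w : ℝ≥0∞ => g (w.toReal / n)) h.measurable_bucketOps.aemeasurable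
    hm.aestronglyMeasurable, h.map_bucketOps hs j,
    integral_map (h.measurable_followCost_cast j).aemeasurable hm.aestronglyMeasurable]
  simp

lemma integrable_bucketOps_pow (h : IsUniformRankModel P μ p n X R) (hs : IsSource p μ ρ)
    (k : ℕ) :
    Integrable (fun ω => ((bucketOps (fun i => X i ω) (R ω)).toReal / n) ^ k) P := by
  rcases n.eq_zero_or_pos with rfl | hn
  · simp
  have hm : Measurable fun w : ℝ≥0∞ => (w.toReal / n) ^ k :=
    (ENNReal.measurable_toReal.div_const _).pow_const k
  have hi := (h.isStringSample.integral_followCost_pow_le hs ⟨0, hn⟩ k).1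
  refine (integrable_map_measure (g := fun w : ℝ≥0∞ => (w.toReal / n) ^ k)
    hm.aestronglyMeasurable h.measurable_bucketOps.aemeasurable).mp ?_
  rw [h.map_bucketOps hs ⟨0, hn⟩, integrable_map_measure hm.aestronglyMeasurable
    (h.measurable_followCost_cast _).aemeasurable]
  simpa [Function.comp_def] using hi

lemma ae_bucketOps_lt_top (h : IsUniformRankModel P μ p n X R) (hs : IsSource p μ ρ) :
    ∀ᵐ ω ∂P, bucketOps (fun i => X i ω) (R ω) < ∞ := by
  rcases n.eq_zero_or_pos with rfl | hn
  · simp [bucketOps_zero]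
  have hset : MeasurableSet {w : ℝ≥0∞ | w < ∞} := measurableSet_Iio
  have hV : ∀ᵐ w ∂(P.map fun ω => (followCost (fun i => X i ω) ⟨0, hn⟩ : ℝ≥0∞)), w < ∞ := by
    rw [ae_map_iff (h.measurable_followCost_cast _).aemeasurable hset]
    simp
  rw [← h.map_bucketOps hs ⟨0, hn⟩, ae_map_iff h.measurable_bucketOps.aemeasurable hset] at hV
  exact hV

lemma integral_pathCost (h : IsUniformRankModel P μ p n X R) (hs : IsSource p μ ρ) (j : Fin n)
    {κ : Measure Str} (hκ : IsChainLaw p μ κ) {g : ℝ → ℝ} (hg : Measurable g) :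
    ∫ ω, g (pathCost p μ (X j ω)) ∂P = ∫ x, g x ∂(κ.map (pathCost p μ)) := by
  have hX := h.isStringSample
  rw [← (hX.isChainLaw j).unique hκ, Measure.map_map hs.measurable_pathCost (hX.measurable j),
    integral_map (hs.measurable_pathCost.comp (hX.measurable j)).aemeasurable
      hg.aestronglyMeasurable]
  rfl

lemma abs_integral_lipschitz_sub_le (h : IsUniformRankModel P μ p n X R) (hs : IsSource p μ ρ)
    (hn : 0 < n) {κ : Measure Str} (hκ : IsChainLaw p μ κ) {g : ℝ → ℝ} {L : NNReal}
    (hL : LipschitzWith L g) {C : ℝ} (hC : ∀ x, |g x| ≤ C) :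
    |∫ ω, g ((bucketOps (fun i => X i ω) (R ω)).toReal / n) ∂P -
      ∫ x, g x ∂(κ.map (pathCost p μ))| ≤ (errorBound ρ + (L : ℝ) ^ 2) / √n := by
  have hX := h.isStringSample
  have hgm : Measurable g := hL.continuous.measurable
  let j : Fin n := ⟨0, hn⟩
  have hmV : Measurable fun ω => (followCost (fun i => X i ω) j : ℝ) / n :=
    ((Measurable.of_discrete (f := fun n : ℕ => (n : ℝ))).comp
      (hX.measurable_followCost j)).div_const _
  have hmZ : Measurable fun ω => pathCost p μ (X j ω) :=
    hs.measurable_pathCost.comp (hX.measurable j)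
  have hgi : ∀ f : Ω → ℝ, Measurable f → Integrable (fun ω => g (f ω)) P := fun f hf =>
    Integrable.of_bound (C := C) (hgm.comp hf).aestronglyMeasurable
      (Eventually.of_forall fun ω => hC _)
  obtain ⟨h1, h2⟩ := hX.integral_error_le hs j
  rw [h.integral_bucketOps hs j hgm, ← h.integral_pathCost hs j hκ hgm]
  refine abs_integral_sub_le_of_sq hn (h := fun _ => (L : ℝ)) (H := fun _ => (L : ℝ) ^ 2) h1 h2
    (integrable_const _) (by simp) (hgi _ hmV) (hgi _ hmZ) (fun _ => le_rfl) fun ω => ?_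
  have := hL.dist_le_mul ((followCost (fun i => X i ω) j : ℝ) / n) (pathCost p μ (X j ω))
  rwa [Real.dist_eq, Real.dist_eq, mul_comm] at this

lemma abs_integral_pow_sub_le (h : IsUniformRankModel P μ p n X R) (hs : IsSource p μ ρ)
    (hn : 0 < n) {κ : Measure Str} (hκ : IsChainLaw p μ κ) (k : ℕ) :
    |∫ ω, ((bucketOps (fun i => X i ω) (R ω)).toReal / n) ^ k ∂P -
      ∫ x, x ^ k ∂(κ.map (pathCost p μ))| ≤
      (errorBound ρ + (k : ℝ) ^ 2 * (2 ^ (2 * (k - 1)) * momentBound ρ (2 * (k - 1)) + 1 +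
        (1 + (1 - ρ)⁻¹) ^ (2 * (k - 1)))) / √n := by
  have hX := h.isStringSample
  have hgm : Measurable fun x : ℝ => x ^ k := measurable_id.pow_const k
  let j : Fin n := ⟨0, hn⟩
  set m := 2 * (k - 1) with hm
  set B := 1 + (1 - ρ)⁻¹ with hB
  have hmZ : Measurable fun ω => pathCost p μ (X j ω) :=
    hs.measurable_pathCost.comp (hX.measurable j)
  obtain ⟨h1, h2⟩ := hX.integral_error_le hs j
  obtain ⟨hVi, hVle⟩ := hX.integral_followCost_pow_le hs j m
  rw [h.integral_bucketOps hs j hgm, ← h.integral_pathCost hs j hκ hgm]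
  -- The power function has the local Lipschitz factor `k * max ^ (k - 1)`. Its square is dominated
  -- by the sum of the two powers of order `m`, whose means are bounded uniformly in `n`.
  refine abs_integral_sub_le_of_sq (g := fun x => x ^ k) hn
    (h := fun ω =>
      k * max |(followCost (fun i => X i ω) j : ℝ) / n| |pathCost p μ (X j ω)| ^ (k - 1))
    (H := fun ω => (k : ℝ) ^ 2 * (((followCost (fun i => X i ω) j : ℝ) / n) ^ m + B ^ m)) h1 h2
    ((hVi.add (integrable_const _)).const_mul _) ?_
    (hX.integral_followCost_pow_le hs j k).1 ?_ (fun ω => ?_) fun ω => ?_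
  · rw [integral_const_mul, integral_add hVi (integrable_const _), integral_const, probReal_univ,
      one_smul]
    gcongr
  · refine Integrable.of_bound (C := B ^ k) (hmZ.pow_const k).aestronglyMeasurable
      (Eventually.of_forall fun ω => ?_)
    have h0 := hs.pathCost_nonneg (X j ω)
    rw [Real.norm_of_nonneg (by positivity)]
    exact pow_le_pow_left₀ h0 (hs.pathCost_le _) k
  · have h0 := hs.pathCost_nonneg (X j ω)
    have hB' := hs.pathCost_le (X j ω)
    have hB0 : 0 ≤ B := h0.trans hB'
    have hV0 : 0 ≤ (followCost (fun i => X i ω) j : ℝ) / n := by positivity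
    rw [mul_pow, ← pow_mul, mul_comm (k - 1) 2, ← hm, abs_of_nonneg h0, abs_of_nonneg hV0]
    gcongr
    rcases max_cases ((followCost (fun i => X i ω) j : ℝ) / n) (pathCost p μ (X j ω)) with
      ⟨e, _⟩ | ⟨e, _⟩ <;> rw [e]
    · exact le_add_of_nonneg_right (by positivity)
    · exact (pow_le_pow_left₀ h0 hB' m).trans (le_add_of_nonneg_left (by positivity))
  · rw [← mul_assoc]
    exact abs_pow_sub_pow_le ..

end IsUniformRankModel

end Model

/-! ### Passage to the limit -/

lemma tendsto_of_abs_sub_le_div_sqrt {a : ℕ → ℝ} {l C : ℝ}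
    (h : ∀ n : ℕ, 0 < n → |a n - l| ≤ C / √n) : Tendsto a atTop (𝓝 l) := by
  have hlim : Tendsto (fun n : ℕ => C / √(n : ℝ)) atTop (𝓝 0) :=
    Tendsto.div_atTop tendsto_const_nhds
      (Real.tendsto_sqrt_atTop.comp tendsto_natCast_atTop_atTop)
  rw [tendsto_iff_dist_tendsto_zero]
  refine squeeze_zero' (Eventually.of_forall fun _ => dist_nonneg) ?_ hlim
  filter_upwards [eventually_gt_atTop 0] with n hn
  rw [Real.dist_eq]
  exact h n hn

lemma IsSource.integrable_pow_map (hs : IsSource p μ ρ) {κ : Measure Str}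
    (hκ : IsChainLaw p μ κ) (k : ℕ) :
    Integrable (fun x : ℝ => x ^ k) (κ.map (pathCost p μ)) := by
  have := hκ.isProbabilityMeasure
  refine (integrable_map_measure (by fun_prop) hs.measurable_pathCost.aemeasurable).mpr ?_
  refine Integrable.of_bound (C := (1 + (1 - ρ)⁻¹) ^ k)
    (hs.measurable_pathCost.pow_const k).aestronglyMeasurable (Eventually.of_forall fun y => ?_)
  have h0 := hs.pathCost_nonneg y
  simp only [Function.comp_apply]
  rw [Real.norm_of_nonneg (by positivity)]
  exact pow_le_pow_left₀ h0 (hs.pathCost_le y) k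

/-- With two states, an entry below `1` forces the other entry of its row to be positive. The
largest of the four entries serves as `ρ`. -/
lemma exists_isSource (hμ : μ ∈ stdSimplex ℝ (Fin 2)) (hp : p ∈ Matrix.rowStochastic ℝ (Fin 2))
    (hp_lt : ∀ i j, p i j < 1) : (∀ i j, 0 < p i j) ∧ ∃ ρ, IsSource p μ ρ := by
  rw [Matrix.mem_rowStochastic_iff_sum] at hp
  obtain ⟨hp0, hps⟩ := hp
  simp only [Fin.sum_univ_two] at hps
  have hpos : ∀ i j, 0 < p i j := by
    intro i
    rw [Fin.forall_fin_two]
    constructor <;> linarith [hps i, hp_lt i 0, hp_lt i 1]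
  refine ⟨hpos, max (max (p 0 0) (p 0 1)) (max (p 1 0) (p 1 1)),
    { init_nonneg := hμ.1
      init_sum := by simpa [Fin.sum_univ_two] using hμ.2
      nonneg := hp0
      sum_row := hps
      le_rho := ?_
      rho_pos := lt_of_lt_of_le (hpos 0 0) ((le_max_left _ _).trans (le_max_left _ _))
      rho_lt_one := by simp [hp_lt] }⟩
  simp [Fin.forall_fin_two]

end RadixSelection

end

open RadixSelection in
theorem theorem3p5
    (μ : Fin 2 → ℝ) (hμ : μ ∈ stdSimplex ℝ (Fin 2))
    (p : Matrix (Fin 2) (Fin 2) ℝ) (hp : p ∈ Matrix.rowStochastic ℝ (Fin 2))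
    (hp_lt : ∀ i j, p i j < 1)
    {Ω : ℕ → Type*} [∀ n, MeasurableSpace (Ω n)]
    (P : (n : ℕ) → Measure (Ω n)) [∀ n, IsProbabilityMeasure (P n)]
    (X : (n : ℕ) → Fin n → Ω n → ℕ → Fin 2) (R : (n : ℕ) → Ω n → ℕ)
    (hmodel : ∀ n, RadixSelection.IsUniformRankModel (P n) μ p n (X n) (R n))
    (W : (n : ℕ) → Ω n → ℝ≥0∞)
    (hW : ∀ n ω, W n ω = RadixSelection.bucketOps (fun i => X n i ω) (R n ω)) :
    -- the complexity is almost surely finite and its mean is `κ_μ n + o(n)`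
    (∀ n, ∀ᵐ ω ∂(P n), W n ω < ∞) ∧
    (∀ n, Integrable (fun ω => (W n ω).toReal) (P n)) ∧
    0 < RadixSelection.kappa μ p ∧
    (fun n : ℕ => (∫ ω, (W n ω).toReal ∂(P n)) - RadixSelection.kappa μ p * n)
      =o[atTop] (fun n : ℕ => (n : ℝ)) ∧
    -- `ν 0, ν 1` are the laws of `Z⁰, Z¹`, and `ζ` is the law of `Z_μ`
    ∃ (ν : Fin 2 → ProbabilityMeasure ℝ) (ζ : ProbabilityMeasure ℝ),
      RadixSelection.IsIntegrableSolution p ν ∧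
      (∀ ν', RadixSelection.IsIntegrableSolution p ν' → ν' = ν) ∧
      (0 < RadixSelection.kappa0 p ∧ ∫ x, x ∂(ν 0 : Measure ℝ) = RadixSelection.kappa0 p) ∧
      (0 < RadixSelection.kappa1 p ∧ ∫ x, x ∂(ν 1 : Measure ℝ) = RadixSelection.kappa1 p) ∧
      (ζ : Measure ℝ) = RadixSelection.mixLaw (μ 0) (ν 0 : Measure ℝ) (ν 1 : Measure ℝ) ∧
      -- convergence in distribution of `W_n / n`, with all moments
      TendstoInDistribution (fun n ω => (W n ω).toReal / n) atTop (fun x : ℝ => x) P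
        (ζ : Measure ℝ) ∧
      ∀ k : ℕ,
        (∀ n, Integrable (fun ω => ((W n ω).toReal / n) ^ k) (P n)) ∧
        Integrable (fun x : ℝ => x ^ k) (ζ : Measure ℝ) ∧
        Tendsto (fun n : ℕ => ∫ ω, ((W n ω).toReal / n) ^ k ∂(P n)) atTop
          (𝓝 (∫ x, x ^ k ∂(ζ : Measure ℝ))) := by
  obtain ⟨hpos, ρ, hs⟩ := exists_isSource hμ hp hp_lt
  obtain rfl : W = fun n ω => bucketOps (fun i => X n i ω) (R n ω) := by
    funext n ω
    exact hW n ω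
  -- The only string of the model with `n = 1` provides the chain law on a space independent of `n`;
  -- the row laws are obtained from it by conditioning.
  have hκ : IsChainLaw p μ ((P 1).map (X 1 0)) := (hmodel 1).isStringSample.isChainLaw 0
  set κ := (P 1).map (X 1 0)
  have hrow : ∀ i, ∃ κ', IsChainLaw p (p i) κ' := fun i => by
    refine exists_chainLaw_row hκ hs.init_nonneg hs.nonneg i ?_
    have h0 := mul_nonneg (hs.init_nonneg 0) (hpos 0 i).le
    have h1 := mul_nonneg (hs.init_nonneg 1) (hpos 1 i).le
    rcases (hs.init_nonneg 0).eq_or_lt with h | h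
    · have : μ 1 = 1 := by linarith [hs.init_sum]
      rw [this] at h1 ⊢
      linarith [hpos 1 i]
    · linarith [mul_pos h (hpos 0 i)]
  choose κr hr using hrow
  have hκp := hκ.isProbabilityMeasure
  have hrp := fun i => (hr i).isProbabilityMeasure
  have hζp := Measure.isProbabilityMeasure_map (μ := κ) hs.measurable_pathCost.aemeasurable
  have hνp := fun i =>
    Measure.isProbabilityMeasure_map (μ := κr i) (hs.row i).measurable_pathCost.aemeasurable
  have hνi : ∀ i, Integrable (fun x : ℝ => x) ((κr i).map (pathCost p (p i))) := fun i => by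
    simpa using (hs.row i).integrable_pow_map (hr i) 1
  have hζeq := hs.map_pathCost hκ hr
  have hνeq := fun i => (hs.row i).map_pathCost (hr i) hr
  have hmean := fun i => integral_id_mixLaw (hs.nonneg i 0) (hp_lt i 0).le (hνi 0) (hνi 1)
  have hkappa := means_eq_kappa hpos hp_lt hs.sum_row
    (by rw [← hmean 0, ← hνeq 0]) (by rw [← hmean 1, ← hνeq 1])
  have hζmean : ∫ x, x ∂(κ.map (pathCost p μ)) = kappa μ p := by
    rw [hζeq, integral_id_mixLaw (hs.init_nonneg 0) (hs.init_le_one 0) (hνi 0) (hνi 1), hkappa.1,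
      hkappa.2, kappa]
  have hmoment : ∀ k : ℕ, Tendsto (fun n : ℕ =>
      ∫ ω, ((bucketOps (fun i => X n i ω) (R n ω)).toReal / n) ^ k ∂(P n)) atTop
      (𝓝 (∫ x, x ^ k ∂(κ.map (pathCost p μ)))) := fun k =>
    tendsto_of_abs_sub_le_div_sqrt fun n hn => (hmodel n).abs_integral_pow_sub_le hs hn hκ k
  have hmeas : ∀ n : ℕ, Measurable fun ω =>
      (bucketOps (fun i => X n i ω) (R n ω)).toReal / (n : ℝ) := fun n =>
    (ENNReal.measurable_toReal.comp (hmodel n).measurable_bucketOps).div_const _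
  have hintg : ∀ n, Integrable (fun ω => (bucketOps (fun i => X n i ω) (R n ω)).toReal) (P n) := by
    intro n
    rcases n.eq_zero_or_pos with rfl | hn
    · simp [bucketOps_zero]
    · have h := ((hmodel n).integrable_bucketOps_pow hs 1).const_mul (n : ℝ)
      have hn' : (n : ℝ) ≠ 0 := by exact_mod_cast hn.ne'
      refine h.congr (Eventually.of_forall fun ω => ?_)
      simp only [pow_one]
      field_simp
  have hdist : TendstoInDistribution
      (fun n ω => (bucketOps (fun i => X n i ω) (R n ω)).toReal / (n : ℝ)) atTop
      (fun x : ℝ => x) P (κ.map (pathCost p μ)) := by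
    refine ⟨fun n => (hmeas n).aemeasurable, by fun_prop, ?_⟩
    -- Weak convergence is tested on bounded Lipschitz functions, to which the mean square estimate
    -- applies.
    refine tendsto_iff_forall_lipschitz_integral_tendsto.mpr ?_
    rintro g ⟨C, hC⟩ ⟨L, hL⟩
    have hb : ∀ x, |g x| ≤ C + |g 0| := fun x => by
      have h1 := hC x 0
      rw [Real.dist_eq] at h1
      have h2 := abs_add_le (g x - g 0) (g 0)
      rw [sub_add_cancel] at h2
      linarith
    have hgm := hL.continuous.measurable
    have h := tendsto_of_abs_sub_le_div_sqrt fun n hn =>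
      (hmodel n).abs_integral_lipschitz_sub_le hs hn hκ hL hb
    convert h using 2 with n
    · exact integral_map (hmeas n).aemeasurable hgm.aestronglyMeasurable
    · simp
  refine ⟨fun n => (hmodel n).ae_bucketOps_lt_top hs, hintg, kappa_pos hpos hp_lt, ?_,
    fun i => ⟨_, hνp i⟩, ⟨_, hζp⟩, fun i => ⟨hνi i, hνeq i⟩, fun ν' hν' => ?_,
    ⟨kappa0_pos hpos hp_lt, hkappa.1⟩, ⟨kappa1_pos hpos hp_lt, hkappa.2⟩, hζeq, hdist,
    fun k => ⟨fun n => (hmodel n).integrable_bucketOps_pow hs k, hs.integrable_pow_map hκ k,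
      hmoment k⟩⟩
  -- The expansion of the mean is the convergence of the first moment.
  · rw [Asymptotics.isLittleO_iff_tendsto' ?_]
    · have h := (hmoment 1).sub_const (kappa μ p)
      simp only [pow_one, hζmean, sub_self] at h
      refine h.congr' ?_
      filter_upwards [eventually_gt_atTop 0] with n hn
      have hn' : (n : ℝ) ≠ 0 := by exact_mod_cast hn.ne'
      rw [integral_div]
      field_simp
    · filter_upwards [eventually_gt_atTop 0] with n hn h
      exact absurd h (by exact_mod_cast hn.ne')
  · exact solution_unique hs.nonneg hs.sum_row hs.le_rho hs.rho_lt_one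
      (fun i => ⟨hνi i, hνeq i⟩) hν'
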